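/- Let $L^2(\mathbb{R})$ be the complex Hilbert space of square-integrable functions on the line (Lebesgue measure), and let $\mathcal{C}$ be the Ces\'aro operator on it, $(\mathcal{C}f)(x)=\frac1x\int_0^x f(t)\,dt$, a bounded operator. For a function $K:\mathbb{R}\to\mathbb{C}$ and a bounded operator $T$ on $L^2(\mathbb{R})$ write $T=\mathcal{H}_K$ (the Hausdorff operator with kernel $K$) if for every $f\in L^2(\mathbb{R})$ and almost every $x\in\mathbb{R}$ the integral $\int_{\mathbb{R}}K(u)f(ux)\,du$ converges absolutely and equals $(Tf)(x)$. Let $(\mathcal{M}K)(z)=\int_0^\infty K(u)u^{z-1}\,du$ be the Mellin transform. The spectrum of $\mathcal{C}$ is the circle $\mathbb{T}+1=\{\lambda\in\mathbb{C}:|\lambda-1|=1\}$. Let $F$ be holomorphic in an open set $N\supseteq\mathbb{T}+1$, and let $F(\mathcal{C})$ be given by the holomorphic functional calculus, $$F(\mathcal{C})=\frac1{2\pi i}\int_{\Gamma}F(\lambda)(\lambda I-\mathcal{C})^{-1}\,d\lambda ,$$ where $\Gamma$ is the positively oriented boundary of an open annulus $\{r<|\lambda-1|<R\}$, $0<r<1<R$,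 whose closure lies in $N$ (such annuli exist, and the integral does not depend on the choice of $r$ and $R$). For a function $K:\mathbb{R}\to\mathbb{C}$ consider the conditions (a) $K(u)=0$ for a.e. $u<0$; (b) $K(u)u^{-1/2}\in L^1(\mathbb{R}_+)$; (c) $(\mathcal{M}K)(z)=F(1/z)$ for all $z\in\mathbb{C}$ with $\operatorname{Re}z=\frac12$. 1) If $F(0)=0$, then $F(\mathcal{C})=\mathcal{H}_K$ for some function $K$ that satisfies (a), (b) and (c), and any function $K'$ with $F(\mathcal{C})=\mathcal{H}_{K'}$ coincides with $K$ almost everywhere. 2) If a function $K$ satisfies (a), (b) and (c), then $F(0)=0$ and $\mathcal{H}_K=F(\mathcal{C})$. -/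

import Mathlib

open MeasureTheory Set Filter Topology

/-- The complex Hilbert space `L²(ℝ)` with respect to Lebesgue measure. -/
abbrev L2R : Type := Lp ℂ 2 (volume : Measure ℝ)

/-- The Cesàro mean `x ↦ (1/x) ∫₀ˣ f(t) dt` of a function on the line. -/
noncomputable def cesaroMean (f : ℝ → ℂ) (x : ℝ) : ℂ :=
  (x : ℂ)⁻¹ * ∫ t in (0 : ℝ)..x, f t

/-- The constant `∫₀¹ u^{-1/2} du`, used as the bound of the Cesàro operator. -/
noncomputable def hardyConst : ENNReal :=
  ∫⁻ u in Ioc (0 : ℝ) 1, ENNReal.ofReal (u ^ (-(1 / 2) : ℝ))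

theorem hardyConst_ne_top : hardyConst ≠ ⊤ := by
  have h : IntervalIntegrable (fun u : ℝ => u ^ (-(1 / 2) : ℝ)) volume 0 1 :=
    intervalIntegral.intervalIntegrable_rpow' (by norm_num)
  rw [intervalIntegrable_iff_integrableOn_Ioc_of_le zero_le_one] at h
  have h2 := h.lintegral_lt_top
  exact h2.ne

theorem lintegral_dilate (g : ℝ → ENNReal) (hg : Measurable g) {u : ℝ} (hu : 0 < u) :
    ∫⁻ x, g (u * x) = ENNReal.ofReal u⁻¹ * ∫⁻ x, g x := by
  have h := Real.map_volume_mul_left hu.ne'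
  rw [← lintegral_map hg (measurable_const_mul u), h, lintegral_smul_measure,
    abs_of_pos (inv_pos.2 hu), smul_eq_mul]

/-- Hardy's inequality in `L²(ℝ)`, for nonnegative functions. -/
theorem hardy_lintegral (g : ℝ → ENNReal) (hg : Measurable g) :
    ∫⁻ x, (∫⁻ u in Ioc (0 : ℝ) 1, g (u * x)) ^ (2 : ℝ)
      ≤ hardyConst ^ (2 : ℝ) * ∫⁻ x, g x ^ (2 : ℝ) := by
  have hm : Measurable fun p : ℝ × ℝ => g (p.1 * p.2) := hg.comp (measurable_fst.mul measurable_snd)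
  have key : ∀ x : ℝ, (∫⁻ u in Ioc (0 : ℝ) 1, g (u * x)) ^ (2 : ℝ) ≤
      hardyConst *
        ∫⁻ u in Ioc (0 : ℝ) 1, ENNReal.ofReal (u ^ (1 / 2 : ℝ)) * g (u * x) ^ (2 : ℝ) := by
    intro x
    have hconj : Real.HolderConjugate 2 2 := Real.HolderConjugate.two_two
    have hcs := ENNReal.lintegral_mul_le_Lp_mul_Lq (volume.restrict (Ioc (0 : ℝ) 1)) hconj
      (f := fun u => ENNReal.ofReal (u ^ (-(1 / 4) : ℝ)))
      (g := fun u => ENNReal.ofReal (u ^ (1 / 4 : ℝ)) * g (u * x))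
      (by fun_prop) (by fun_prop)
    have e1 : ∫⁻ u in Ioc (0 : ℝ) 1, g (u * x) =
        ∫⁻ u in Ioc (0 : ℝ) 1, ((fun u => ENNReal.ofReal (u ^ (-(1 / 4) : ℝ))) *
          (fun u => ENNReal.ofReal (u ^ (1 / 4 : ℝ)) * g (u * x))) u := by
      refine setLIntegral_congr_fun measurableSet_Ioc fun u hu => ?_
      have h0 : 0 < u := hu.1
      simp only [Pi.mul_apply]
      rw [← mul_assoc, ← ENNReal.ofReal_mul (by positivity), ← Real.rpow_add h0]
      norm_num
    have e2 : ∫⁻ u in Ioc (0 : ℝ) 1, ENNReal.ofReal (u ^ (-(1 / 4) : ℝ)) ^ (2 : ℝ) = hardyConst := by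
      refine setLIntegral_congr_fun measurableSet_Ioc fun u hu => ?_
      have h0 : 0 < u := hu.1
      rw [ENNReal.ofReal_rpow_of_pos (by positivity), ← Real.rpow_mul h0.le]
      norm_num
    have e3 : ∫⁻ u in Ioc (0 : ℝ) 1, (ENNReal.ofReal (u ^ (1 / 4 : ℝ)) * g (u * x)) ^ (2 : ℝ) =
        ∫⁻ u in Ioc (0 : ℝ) 1, ENNReal.ofReal (u ^ (1 / 2 : ℝ)) * g (u * x) ^ (2 : ℝ) := by
      refine setLIntegral_congr_fun measurableSet_Ioc fun u hu => ?_
      have h0 : 0 < u := hu.1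
      rw [ENNReal.mul_rpow_of_nonneg _ _ (by norm_num),
        ENNReal.ofReal_rpow_of_pos (by positivity), ← Real.rpow_mul h0.le]
      norm_num
    rw [← e1] at hcs
    rw [e2, e3] at hcs
    calc (∫⁻ u in Ioc (0 : ℝ) 1, g (u * x)) ^ (2 : ℝ) ≤ _ :=
          ENNReal.rpow_le_rpow hcs (by norm_num)
      _ = _ := by
          rw [ENNReal.mul_rpow_of_nonneg _ _ (by norm_num), ← ENNReal.rpow_mul,
            ← ENNReal.rpow_mul]
          norm_num
  calc ∫⁻ x, (∫⁻ u in Ioc (0 : ℝ) 1, g (u * x)) ^ (2 : ℝ)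
      ≤ ∫⁻ x, hardyConst *
        ∫⁻ u in Ioc (0 : ℝ) 1, ENNReal.ofReal (u ^ (1 / 2 : ℝ)) * g (u * x) ^ (2 : ℝ) :=
        lintegral_mono key
    _ = hardyConst * ∫⁻ x, ∫⁻ u in Ioc (0 : ℝ) 1,
          ENNReal.ofReal (u ^ (1 / 2 : ℝ)) * g (u * x) ^ (2 : ℝ) :=
        lintegral_const_mul' _ _ hardyConst_ne_top
    _ = hardyConst * ∫⁻ u in Ioc (0 : ℝ) 1, ∫⁻ x,
          ENNReal.ofReal (u ^ (1 / 2 : ℝ)) * g (u * x) ^ (2 : ℝ) := by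
        rw [lintegral_lintegral_swap]
        have : Measurable fun p : ℝ × ℝ =>
            ENNReal.ofReal (p.2 ^ (1 / 2 : ℝ)) * g (p.2 * p.1) ^ (2 : ℝ) := by fun_prop
        exact this.aemeasurable
    _ = hardyConst * ∫⁻ u in Ioc (0 : ℝ) 1,
          ENNReal.ofReal (u ^ (-(1 / 2) : ℝ)) * ∫⁻ x, g x ^ (2 : ℝ) := by
        congr 1
        refine setLIntegral_congr_fun measurableSet_Ioc fun u hu => ?_
        have h0 : 0 < u := hu.1
        rw [lintegral_const_mul _ (by fun_prop),
          lintegral_dilate (fun y => g y ^ (2 : ℝ)) (by fun_prop) h0, ← mul_assoc,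
          ← ENNReal.ofReal_mul (by positivity), ← Real.rpow_neg_one u, ← Real.rpow_add h0]
        norm_num
    _ = hardyConst ^ (2 : ℝ) * ∫⁻ x, g x ^ (2 : ℝ) := by
        rw [lintegral_mul_const _ (by fun_prop), ← mul_assoc]
        congr 1
        rw [ENNReal.rpow_two, sq]
        rfl

/-- The two usual formulas for the Cesàro mean agree off the origin. -/
theorem cesaroMean_eq (f : ℝ → ℂ) {x : ℝ} (hx : x ≠ 0) :
    cesaroMean f x = ∫ u in (0 : ℝ)..1, f (u * x) := by
  rw [intervalIntegral.integral_comp_mul_right f hx, cesaroMean, zero_mul, one_mul,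
    Complex.real_smul, Complex.ofReal_inv]

theorem L2R.intervalIntegrable (f : L2R) (a b : ℝ) : IntervalIntegrable f volume a b :=
  (((Lp.memLp f).locallyIntegrable (by norm_num)).integrableOn_isCompact
    isCompact_uIcc).intervalIntegrable

theorem cesaroMean_aestronglyMeasurable (f : L2R) :
    AEStronglyMeasurable (cesaroMean f) volume := by
  have h1 : Continuous fun x : ℝ => ∫ t in (0 : ℝ)..x, f t :=
    intervalIntegral.continuous_primitive (fun a b => L2R.intervalIntegrable f a b) 0
  have h2 : Measurable fun x : ℝ => (x : ℂ)⁻¹ := by fun_prop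
  exact (h2.mul h1.measurable).aestronglyMeasurable

theorem eLpNorm_cesaroMean_le (f : L2R) :
    eLpNorm (cesaroMean f) 2 volume ≤ hardyConst * eLpNorm f 2 volume := by
  have h2 : (2 : ENNReal).toReal = 2 := by norm_num
  rw [eLpNorm_eq_lintegral_rpow_enorm_toReal (by norm_num) (by norm_num),
    eLpNorm_eq_lintegral_rpow_enorm_toReal (by norm_num) (by norm_num), h2]
  have hg : Measurable fun x => ‖f x‖ₑ := (Lp.stronglyMeasurable f).measurable.enorm
  have hle : ∫⁻ x, ‖cesaroMean f x‖ₑ ^ (2 : ℝ) ≤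
      hardyConst ^ (2 : ℝ) * ∫⁻ x, ‖f x‖ₑ ^ (2 : ℝ) := by
    refine le_trans (lintegral_mono_ae ?_) (hardy_lintegral _ hg)
    have h0 : ∀ᵐ x : ℝ, x ≠ 0 := by simp [ae_iff]
    filter_upwards [h0] with x hx
    refine ENNReal.rpow_le_rpow ?_ (by norm_num)
    rw [cesaroMean_eq f hx, intervalIntegral.integral_of_le zero_le_one]
    exact enorm_integral_le_lintegral_enorm _
  calc _ ≤ (hardyConst ^ (2 : ℝ) * ∫⁻ x, ‖f x‖ₑ ^ (2 : ℝ)) ^ (1 / 2 : ℝ) :=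
        ENNReal.rpow_le_rpow hle (by norm_num)
    _ = _ := by
        rw [ENNReal.mul_rpow_of_nonneg _ _ (by norm_num), ← ENNReal.rpow_mul]
        norm_num

theorem cesaroMean_memLp (f : L2R) : MemLp (cesaroMean f) 2 volume :=
  ⟨cesaroMean_aestronglyMeasurable f, (eLpNorm_cesaroMean_le f).trans_lt
    (ENNReal.mul_lt_top hardyConst_ne_top.lt_top (Lp.eLpNorm_lt_top f))⟩

theorem cesaroMean_congr {f g : ℝ → ℂ} (h : f =ᵐ[volume] g) : cesaroMean f = cesaroMean g := by
  funext x
  unfold cesaroMean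
  rw [intervalIntegral.integral_congr_ae (h.mono fun t ht _ => ht)]

/-- The Cesàro operator `(𝒞 f)(x) = (1/x) ∫₀ˣ f(t) dt` as a bounded operator on `L²(ℝ)`. -/
noncomputable def cesaro : L2R →L[ℂ] L2R :=
  LinearMap.mkContinuous
    { toFun := fun f => (cesaroMean_memLp f).toLp (cesaroMean f)
      map_add' := by
        intro f g
        rw [← MemLp.toLp_add]
        refine MemLp.toLp_congr _ _ (Eventually.of_forall fun x => ?_)
        rw [cesaroMean_congr (Lp.coeFn_add f g)]
        simp only [cesaroMean, Pi.add_apply]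
        rw [intervalIntegral.integral_add (L2R.intervalIntegrable f 0 x)
          (L2R.intervalIntegrable g 0 x), mul_add]
      map_smul' := by
        intro c f
        rw [RingHom.id_apply, ← MemLp.toLp_const_smul]
        refine MemLp.toLp_congr _ _ (Eventually.of_forall fun x => ?_)
        rw [cesaroMean_congr (Lp.coeFn_smul c f)]
        simp only [cesaroMean, Pi.smul_apply, smul_eq_mul]
        rw [intervalIntegral.integral_const_mul]
        ring }
    hardyConst.toReal
    (by
      intro f
      simp only [LinearMap.coe_mk, AddHom.coe_mk]
      rw [Lp.norm_toLp, Lp.norm_def, ← ENNReal.toReal_mul]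
      exact ENNReal.toReal_mono (ENNReal.mul_ne_top hardyConst_ne_top (Lp.eLpNorm_ne_top f))
        (eLpNorm_cesaroMean_le f))

theorem cesaro_apply_ae (f : L2R) : cesaro f =ᵐ[volume] cesaroMean f :=
  MemLp.coeFn_toLp (cesaroMean_memLp f)

/-- `T = 𝓗_K`: the bounded operator `T` on `L²(ℝ)` is the Hausdorff operator with kernel `K`, that
is, for every `f ∈ L²(ℝ)` and almost every `x` the integral `∫_ℝ K(u) f(ux) du` converges
absolutely and its value is `(T f)(x)`. -/
def IsHausdorffOperator (K : ℝ → ℂ) (T : L2R →L[ℂ] L2R) : Prop :=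
  ∀ f : L2R, ∀ᵐ x : ℝ,
    Integrable (fun u : ℝ => K u * f (u * x)) ∧ T f x = ∫ u : ℝ, K u * f (u * x)

section HolomorphicCalculus

variable {A : Type*} [NormedRing A] [NormedAlgebra ℂ A]

/-- The boundary of the open annulus `r < |z - c| < R` is an admissible contour for the holomorphic
functional calculus of `a` on `N`: the open annulus contains the spectrum of `a` and the closed
annulus is contained in `N`. -/
structure IsAdmissibleAnnulus (a : A) (N : Set ℂ) (c : ℂ) (r R : ℝ) : Prop where
  inner_pos : 0 < r
  inner_lt_outer : r < R
  spectrum_subset : spectrum ℂ a ⊆ {z | r < ‖z - c‖ ∧ ‖z - c‖ < R}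
  closed_subset : {z | r ≤ ‖z - c‖ ∧ ‖z - c‖ ≤ R} ⊆ N

/-- The Riesz–Dunford integral `(1/2πi) ∫_Γ F(λ) (λ - a)⁻¹ dλ` over the positively oriented boundary
`Γ` of the annulus `r < |z - c| < R`. -/
noncomputable def rieszDunford (F : ℂ → ℂ) (a : A) (c : ℂ) (r R : ℝ) : A :=
  (2 * Real.pi * Complex.I : ℂ)⁻¹ •
    ((∮ z in C(c, R), F z • resolvent a z) - ∮ z in C(c, r), F z • resolvent a z)

/-- `b = F(a)` in the sense of the holomorphic functional calculus, for `F` holomorphic on an open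
set `N` that contains a closed annulus centred at `c` around the spectrum of `a`: there are
admissible annuli, and `b` is the Riesz–Dunford integral over the boundary of each of them. -/
def IsHolomorphicFunctionOf (F : ℂ → ℂ) (N : Set ℂ) (c : ℂ) (a b : A) : Prop :=
  (∃ r R : ℝ, IsAdmissibleAnnulus a N c r R) ∧
    ∀ r R : ℝ, IsAdmissibleAnnulus a N c r R → b = rieszDunford F a c r R

end HolomorphicCalculus

/-! The resolvent of the Cesàro operator is explicit: off the circle `|λ - 1| = 1`, it is `λ⁻¹ + λ⁻²
𝓗_k`, where `k(u) = u^{-1/λ}` on `(0, 1]` if `|λ - 1| > 1`, and `k(u) = -u^{-1/λ}` on `(1, ∞)` if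
`|λ - 1| < 1`. Since `λ ↦ 1/λ` sends the circle (without `0`) to the line `Re = 1/2`, these are
exactly the ranges where `k(u) u^{-1/2}` is integrable. Such kernels give bounded operators by
Schur's test. The resolvent identity reduces to `λ⁻¹ ∫_s^∞ k(u)/u du = k(s) - 1_{(0,1]}(s)`
(`resolvent_cesaro_of_isHausdorffOperator`).

Put this into the contour integral. By Cauchy's formula in the annulus the terms `λ⁻¹` contribute
`F(0)`, as `0` lies on the circle. Fubini, applied to matrix coefficients `⟨g, · f⟩`, turns the rest
into one Hausdorff operator, so `F(𝒞) = F(0) + 𝓗_K` with `K` a contour integral of powers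
(`rieszDunford_cesaro`). By partial fractions and Cauchy's formula again, `(𝓜K)(z) = F(1/z) - F(0)`
on `Re z = 1/2` (`mellin_holomorphicKernel`).

The substitution `u = e^{-x}` makes the Mellin transform on that line the Fourier transform of an
integrable function. If it is constant, the constant is `0` by Riemann–Lebesgue and the function
vanishes by injectivity (`eq_zero_of_mellin_const`). This yields part 2, where the two Mellin
transforms differ by the constant `F(0)`, and the independence of the annulus. The uniqueness in
part 1 assumes neither (a) nor (b) of the competing kernel, so it is proved directly, by testing on
`1_{(0,1]}` (`IsHausdorffOperator.kernel_unique`). -/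

/-! ### Boundedness of Hausdorff operators -/

/-- Schur's test for Hausdorff operators on `L²(ℝ)`, for nonnegative functions. -/
theorem lintegral_hausdorff_le (k g : ℝ → ENNReal) (hk : Measurable k) (hk0 : ∀ u ≤ 0, k u = 0)
    (hfin : ∫⁻ u, k u * ENNReal.ofReal (u ^ (-(1 / 2) : ℝ)) ≠ ⊤) (hg : Measurable g) :
    ∫⁻ x, (∫⁻ u, k u * g (u * x)) ^ (2 : ℝ)
      ≤ (∫⁻ u, k u * ENNReal.ofReal (u ^ (-(1 / 2) : ℝ))) ^ (2 : ℝ) * ∫⁻ x, g x ^ (2 : ℝ) := by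
  set c := ∫⁻ u, k u * ENNReal.ofReal (u ^ (-(1 / 2) : ℝ)) with hc
  have hkk : ∀ u, k u ^ (1 / 2 : ℝ) * k u ^ (1 / 2 : ℝ) = k u := fun u => by
    rw [← ENNReal.rpow_add_of_nonneg _ _ (by norm_num) (by norm_num)]
    norm_num
  have hk2 : ∀ u, (k u ^ (1 / 2 : ℝ)) ^ (2 : ℝ) = k u := fun u => by
    rw [← ENNReal.rpow_mul]
    norm_num
  have key : ∀ x : ℝ, (∫⁻ u, k u * g (u * x)) ^ (2 : ℝ) ≤
      c * ∫⁻ u, k u * (ENNReal.ofReal (u ^ (1 / 2 : ℝ)) * g (u * x) ^ (2 : ℝ)) := by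
    intro x
    have hconj : Real.HolderConjugate 2 2 := Real.HolderConjugate.two_two
    -- Cauchy–Schwarz with weights `u^{∓1/4}`: the first factor squares to `k(u) u^{-1/2}`, with
    -- integral `c`. The second keeps `u^{1/2}`, which the factor `u⁻¹` from the dilation later
    -- turns into `u^{-1/2}`, giving the second `c`.
    have hcs := ENNReal.lintegral_mul_le_Lp_mul_Lq volume hconj
      (f := fun u => k u ^ (1 / 2 : ℝ) * ENNReal.ofReal (u ^ (-(1 / 4) : ℝ)))
      (g := fun u => k u ^ (1 / 2 : ℝ) * (ENNReal.ofReal (u ^ (1 / 4 : ℝ)) * g (u * x)))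
      (by fun_prop) (by fun_prop)
    have e1 : ∫⁻ u, k u * g (u * x) =
        ∫⁻ u, ((fun u => k u ^ (1 / 2 : ℝ) * ENNReal.ofReal (u ^ (-(1 / 4) : ℝ))) *
          (fun u => k u ^ (1 / 2 : ℝ) * (ENNReal.ofReal (u ^ (1 / 4 : ℝ)) * g (u * x)))) u := by
      refine lintegral_congr fun u => ?_
      rcases le_or_gt u 0 with h | h0
      · simp [hk0 u h]
      simp only [Pi.mul_apply]
      rw [mul_mul_mul_comm, hkk, ← mul_assoc (ENNReal.ofReal _), ← ENNReal.ofReal_mul (by positivity),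
        ← Real.rpow_add h0]
      norm_num
    have e2 : ∫⁻ u, (k u ^ (1 / 2 : ℝ) * ENNReal.ofReal (u ^ (-(1 / 4) : ℝ))) ^ (2 : ℝ) = c := by
      refine lintegral_congr fun u => ?_
      rcases le_or_gt u 0 with h | h0
      · simp [hk0 u h]
      rw [ENNReal.mul_rpow_of_nonneg _ _ (by norm_num), hk2,
        ENNReal.ofReal_rpow_of_pos (by positivity), ← Real.rpow_mul h0.le]
      norm_num
    have e3 : ∫⁻ u, (k u ^ (1 / 2 : ℝ) * (ENNReal.ofReal (u ^ (1 / 4 : ℝ)) * g (u * x))) ^ (2 : ℝ) =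
        ∫⁻ u, k u * (ENNReal.ofReal (u ^ (1 / 2 : ℝ)) * g (u * x) ^ (2 : ℝ)) := by
      refine lintegral_congr fun u => ?_
      rcases le_or_gt u 0 with h | h0
      · simp [hk0 u h]
      rw [ENNReal.mul_rpow_of_nonneg _ _ (by norm_num), hk2,
        ENNReal.mul_rpow_of_nonneg _ _ (by norm_num),
        ENNReal.ofReal_rpow_of_pos (by positivity), ← Real.rpow_mul h0.le]
      norm_num
    rw [← e1] at hcs
    rw [e2, e3] at hcs
    calc (∫⁻ u, k u * g (u * x)) ^ (2 : ℝ) ≤ _ :=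
          ENNReal.rpow_le_rpow hcs (by norm_num)
      _ = _ := by
          rw [ENNReal.mul_rpow_of_nonneg _ _ (by norm_num), ← ENNReal.rpow_mul,
            ← ENNReal.rpow_mul]
          norm_num
  calc ∫⁻ x, (∫⁻ u, k u * g (u * x)) ^ (2 : ℝ)
      ≤ ∫⁻ x, c * ∫⁻ u, k u * (ENNReal.ofReal (u ^ (1 / 2 : ℝ)) * g (u * x) ^ (2 : ℝ)) :=
        lintegral_mono key
    _ = c * ∫⁻ x, ∫⁻ u, k u * (ENNReal.ofReal (u ^ (1 / 2 : ℝ)) * g (u * x) ^ (2 : ℝ)) :=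
        lintegral_const_mul' _ _ hfin
    _ = c * ∫⁻ u, ∫⁻ x, k u * (ENNReal.ofReal (u ^ (1 / 2 : ℝ)) * g (u * x) ^ (2 : ℝ)) := by
        rw [lintegral_lintegral_swap]
        have : Measurable fun p : ℝ × ℝ =>
            k p.2 * (ENNReal.ofReal (p.2 ^ (1 / 2 : ℝ)) * g (p.2 * p.1) ^ (2 : ℝ)) := by fun_prop
        exact this.aemeasurable
    _ = c * ∫⁻ u, (k u * ENNReal.ofReal (u ^ (-(1 / 2) : ℝ))) * ∫⁻ x, g x ^ (2 : ℝ) := by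
        congr 1
        refine lintegral_congr fun u => ?_
        rcases le_or_gt u 0 with h | h0
        · simp [hk0 u h]
        rw [lintegral_const_mul _ (by fun_prop), lintegral_const_mul _ (by fun_prop),
          lintegral_dilate (fun y => g y ^ (2 : ℝ)) (by fun_prop) h0,
          ← mul_assoc (ENNReal.ofReal _), mul_assoc (k u),
          ← ENNReal.ofReal_mul (by positivity), ← Real.rpow_neg_one u, ← Real.rpow_add h0]
        norm_num
    _ = c ^ (2 : ℝ) * ∫⁻ x, g x ^ (2 : ℝ) := by
        rw [lintegral_mul_const _ (by fun_prop), ← mul_assoc]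
        congr 1
        rw [ENNReal.rpow_two, sq]

/-- A measurable kernel carried by the positive half line, integrable against `u^{-1/2}`. -/
structure IsHausdorffKernel (K : ℝ → ℂ) : Prop where
  measurable : Measurable K
  zero_of_nonpos : ∀ u ≤ 0, K u = 0
  integrableOn : IntegrableOn (fun u : ℝ => K u * ((u ^ (-(1 / 2) : ℝ) : ℝ) : ℂ)) (Ioi 0)

theorem integral_eq_setIntegral_Ioi {K : ℝ → ℂ} (hK : ∀ u ≤ 0, K u = 0) (φ : ℝ → ℂ) :
    ∫ u, K u * φ u = ∫ u in Ioi (0 : ℝ), K u * φ u := by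
  symm
  refine setIntegral_eq_integral_of_forall_compl_eq_zero fun u hu => ?_
  rw [hK u (not_lt.1 hu), zero_mul]

namespace IsHausdorffKernel

variable {K : ℝ → ℂ}

theorem integrable (hK : IsHausdorffKernel K) :
    Integrable (fun u : ℝ => K u * ((u ^ (-(1 / 2) : ℝ) : ℝ) : ℂ)) := by
  refine (integrableOn_iff_integrable_of_support_subset fun u hu => ?_).1 hK.integrableOn
  by_contra h
  exact hu (by simp only [hK.zero_of_nonpos u (not_lt.1 h), zero_mul])

theorem lintegral_ne_top (hK : IsHausdorffKernel K) :
    ∫⁻ u, ‖K u‖ₑ * ENNReal.ofReal (u ^ (-(1 / 2) : ℝ)) ≠ ⊤ := by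
  have h := hK.integrable.2.ne
  convert h using 2
  ext u
  rcases le_or_gt u 0 with h | h0
  · simp [hK.zero_of_nonpos u h]
  · rw [enorm_mul]
    congr 1
    rw [← ofReal_norm, Complex.norm_real, Real.norm_of_nonneg (by positivity)]

/-- A kernel may be integrated against a function that is `O(u^{-1/2})`. -/
theorem integrable_mul (hK : IsHausdorffKernel K) {φ : ℝ → ℂ}
    (hφ : AEStronglyMeasurable φ volume) {C : ℝ}
    (hC : ∀ u : ℝ, 0 < u → ‖φ u‖ ≤ C * u ^ (-(1 / 2) : ℝ)) : Integrable fun u => K u * φ u := by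
  refine (hK.integrable.norm.const_mul C).mono' (hK.measurable.aestronglyMeasurable.mul hφ)
    (Eventually.of_forall fun u => ?_)
  rcases le_or_gt u 0 with h | h0
  · simp [hK.zero_of_nonpos u h]
  · rw [norm_mul, norm_mul, Complex.norm_real, Real.norm_of_nonneg (by positivity)]
    nlinarith [mul_le_mul_of_nonneg_left (hC u h0) (norm_nonneg (K u))]

theorem lintegral_le (hK : IsHausdorffKernel K) {f : ℝ → ℂ} (hf : Measurable f) :
    ∫⁻ x, (∫⁻ u, ‖K u * f (u * x)‖ₑ) ^ (2 : ℝ) ≤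
      (∫⁻ u, ‖K u‖ₑ * ENNReal.ofReal (u ^ (-(1 / 2) : ℝ))) ^ (2 : ℝ) *
        ∫⁻ x, ‖f x‖ₑ ^ (2 : ℝ) := by
  simp_rw [enorm_mul]
  exact lintegral_hausdorff_le (fun u => ‖K u‖ₑ) (fun x => ‖f x‖ₑ) hK.measurable.enorm
    (fun u hu => by simp [hK.zero_of_nonpos u hu]) hK.lintegral_ne_top hf.enorm

end IsHausdorffKernel

theorem L2R.measurable (f : L2R) : Measurable f := (Lp.stronglyMeasurable f).measurable

theorem lintegral_sq_ne_top {f : ℝ → ℂ} (hf : MemLp f 2 volume) :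
    ∫⁻ x, ‖f x‖ₑ ^ (2 : ℝ) ≠ ⊤ := by
  have := lintegral_rpow_enorm_lt_top_of_eLpNorm_lt_top (p := 2) (by norm_num) (by norm_num) hf.2
  simpa using this.ne

theorem ae_ne_zero : ∀ᵐ x : ℝ, x ≠ 0 := by simp [ae_iff]

theorem ae_eq_comp_mul {f g : ℝ → ℂ} (h : f =ᵐ[volume] g) {x : ℝ} (hx : x ≠ 0) :
    (fun u => f (u * x)) =ᵐ[volume] fun u => g (u * x) := by
  have hq : Measure.QuasiMeasurePreserving (fun u : ℝ => u * x) volume volume :=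
    ⟨measurable_mul_const x, by
      rw [Real.map_volume_mul_right hx]
      exact Measure.smul_absolutelyContinuous⟩
  exact hq.ae_eq_comp h

namespace IsHausdorffKernel

variable {K : ℝ → ℂ}

/-- Schur's test bounds the integral over `x` of the squared absolute integral, which is therefore
finite for almost every `x`. -/
theorem ae_integrable (hK : IsHausdorffKernel K) (f : L2R) :
    ∀ᵐ x : ℝ, Integrable fun u => K u * f (u * x) := by
  have hm : Measurable fun p : ℝ × ℝ => K p.2 * f (p.2 * p.1) :=
    (hK.measurable.comp measurable_snd).mul (f.measurable.comp (measurable_snd.mul measurable_fst))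
  have hlt : ∫⁻ x, (∫⁻ u, ‖K u * f (u * x)‖ₑ) ^ (2 : ℝ) ≠ ⊤ :=
    ((hK.lintegral_le f.measurable).trans_lt (ENNReal.mul_lt_top
      (ENNReal.rpow_lt_top_of_nonneg (by norm_num) hK.lintegral_ne_top)
      (lintegral_sq_ne_top (Lp.memLp f)).lt_top)).ne
  have hm2 : Measurable fun x : ℝ => ∫⁻ u, ‖K u * f (u * x)‖ₑ := hm.enorm.lintegral_prod_right'
  filter_upwards [ae_lt_top (hm2.pow_const _) hlt] with x hx
  refine ⟨(hm.comp (measurable_const.prodMk measurable_id)).aestronglyMeasurable, ?_⟩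
  rw [HasFiniteIntegral]
  exact (ENNReal.rpow_lt_top_iff_of_pos (by norm_num)).1 hx

theorem aestronglyMeasurable_integral (hK : IsHausdorffKernel K) (f : L2R) :
    AEStronglyMeasurable (fun x : ℝ => ∫ u, K u * f (u * x)) volume := by
  have hm : Measurable fun p : ℝ × ℝ => K p.2 * f (p.2 * p.1) :=
    (hK.measurable.comp measurable_snd).mul (f.measurable.comp (measurable_snd.mul measurable_fst))
  exact (hm.stronglyMeasurable.integral_prod_right' (ν := volume)).aestronglyMeasurable

theorem eLpNorm_integral_le (hK : IsHausdorffKernel K) (f : L2R) :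
    eLpNorm (fun x : ℝ => ∫ u, K u * f (u * x)) 2 volume ≤
      (∫⁻ u, ‖K u‖ₑ * ENNReal.ofReal (u ^ (-(1 / 2) : ℝ))) * eLpNorm f 2 volume := by
  have h2 : (2 : ENNReal).toReal = 2 := by norm_num
  rw [eLpNorm_eq_lintegral_rpow_enorm_toReal (by norm_num) (by norm_num),
    eLpNorm_eq_lintegral_rpow_enorm_toReal (by norm_num) (by norm_num), h2]
  have hle : ∫⁻ x, ‖∫ u, K u * f (u * x)‖ₑ ^ (2 : ℝ) ≤
      (∫⁻ u, ‖K u‖ₑ * ENNReal.ofReal (u ^ (-(1 / 2) : ℝ))) ^ (2 : ℝ) *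
        ∫⁻ x, ‖f x‖ₑ ^ (2 : ℝ) := by
    refine le_trans (lintegral_mono fun x => ?_) (hK.lintegral_le f.measurable)
    exact ENNReal.rpow_le_rpow (enorm_integral_le_lintegral_enorm _) (by norm_num)
  calc _ ≤ _ := ENNReal.rpow_le_rpow hle (by norm_num)
    _ = _ := by
        rw [ENNReal.mul_rpow_of_nonneg _ _ (by norm_num), ← ENNReal.rpow_mul]
        norm_num

theorem memLp_integral (hK : IsHausdorffKernel K) (f : L2R) :
    MemLp (fun x : ℝ => ∫ u, K u * f (u * x)) 2 volume :=
  ⟨hK.aestronglyMeasurable_integral f, (hK.eLpNorm_integral_le f).trans_lt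
    (ENNReal.mul_lt_top hK.lintegral_ne_top.lt_top (Lp.eLpNorm_lt_top f))⟩

/-- The Hausdorff operator of a kernel. -/
noncomputable def operator (hK : IsHausdorffKernel K) : L2R →L[ℂ] L2R :=
  LinearMap.mkContinuous
    { toFun := fun f => (hK.memLp_integral f).toLp _
      map_add' := by
        intro f g
        rw [← MemLp.toLp_add]
        refine MemLp.toLp_congr _ _ ?_
        filter_upwards [ae_ne_zero, hK.ae_integrable f, hK.ae_integrable g] with x hx hf hg
        rw [Pi.add_apply, ← integral_add hf hg]
        refine integral_congr_ae ?_
        filter_upwards [ae_eq_comp_mul (Lp.coeFn_add f g) hx] with u hu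
        rw [hu, Pi.add_apply, mul_add]
      map_smul' := by
        intro c f
        rw [RingHom.id_apply, ← MemLp.toLp_const_smul]
        refine MemLp.toLp_congr _ _ ?_
        filter_upwards [ae_ne_zero] with x hx
        rw [Pi.smul_apply, ← integral_smul]
        refine integral_congr_ae ?_
        filter_upwards [ae_eq_comp_mul (Lp.coeFn_smul c f) hx] with u hu
        rw [hu, Pi.smul_apply, smul_eq_mul, smul_eq_mul]
        ring }
    (∫⁻ u, ‖K u‖ₑ * ENNReal.ofReal (u ^ (-(1 / 2) : ℝ))).toReal
    (by
      intro f
      simp only [LinearMap.coe_mk, AddHom.coe_mk]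
      rw [Lp.norm_toLp, Lp.norm_def, ← ENNReal.toReal_mul]
      exact ENNReal.toReal_mono (ENNReal.mul_ne_top hK.lintegral_ne_top (Lp.eLpNorm_ne_top f))
        (hK.eLpNorm_integral_le f))

theorem isHausdorffOperator (hK : IsHausdorffKernel K) : IsHausdorffOperator K hK.operator :=
  fun f => (hK.ae_integrable f).and (MemLp.coeFn_toLp (hK.memLp_integral f))

end IsHausdorffKernel

theorem IsHausdorffOperator.congr {K K' : ℝ → ℂ} {T : L2R →L[ℂ] L2R}
    (h : IsHausdorffOperator K T) (hK : K =ᵐ[volume] K') : IsHausdorffOperator K' T := by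
  intro f
  filter_upwards [h f] with x hx
  have : (fun u : ℝ => K u * f (u * x)) =ᵐ[volume] fun u => K' u * f (u * x) := by
    filter_upwards [hK] with u hu
    rw [hu]
  exact ⟨hx.1.congr this, hx.2.trans (integral_congr_ae this)⟩

theorem IsHausdorffOperator.unique {K : ℝ → ℂ} {S T : L2R →L[ℂ] L2R}
    (hS : IsHausdorffOperator K S) (hT : IsHausdorffOperator K T) : S = T := by
  ext1 f
  refine Lp.ext ?_
  filter_upwards [hS f, hT f] with x h1 h2
  rw [h1.2, h2.2]

/-! ### Weak form, composition and commutation of Hausdorff operators -/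

/-- The pairing `u ↦ ∫ g(x) f(ux) dx` of a function with the dilations of another. -/
noncomputable def dilationPairing (g f : ℝ → ℂ) (u : ℝ) : ℂ := ∫ x, g x * f (u * x)

theorem measurable_dilationPairing {g f : ℝ → ℂ} (hg : Measurable g) (hf : Measurable f) :
    Measurable (dilationPairing g f) := by
  have hm : Measurable fun p : ℝ × ℝ => g p.2 * f (p.1 * p.2) :=
    (hg.comp measurable_snd).mul (hf.comp (measurable_fst.mul measurable_snd))
  exact (hm.stronglyMeasurable.integral_prod_right' (ν := volume)).measurable

/-- Cauchy–Schwarz, with the dilation by `u` scaling the `L²` norm by `u^{-1/2}`. This is the decay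
that condition (b) is made for: it justifies each later use of Fubini's theorem. -/
theorem exists_norm_dilationPairing_le {g f : ℝ → ℂ} (hg : Measurable g) (hf : Measurable f)
    (hg2 : MemLp g 2 volume) (hf2 : MemLp f 2 volume) :
    ∃ C : ℝ, ∀ u : ℝ, 0 < u → ‖dilationPairing g f u‖ ≤ C * u ^ (-(1 / 2) : ℝ) := by
  set A := ∫⁻ x, ‖g x‖ₑ ^ (2 : ℝ) with hA
  set B := ∫⁻ x, ‖f x‖ₑ ^ (2 : ℝ) with hB
  have hA' : A ^ (1 / 2 : ℝ) ≠ ⊤ :=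
    (ENNReal.rpow_lt_top_of_nonneg (by norm_num) (lintegral_sq_ne_top hg2)).ne
  have hB' : B ^ (1 / 2 : ℝ) ≠ ⊤ :=
    (ENNReal.rpow_lt_top_of_nonneg (by norm_num) (lintegral_sq_ne_top hf2)).ne
  refine ⟨(A ^ (1 / 2 : ℝ) * B ^ (1 / 2 : ℝ)).toReal, fun u hu => ?_⟩
  have h1 : ‖dilationPairing g f u‖ₑ ≤
      A ^ (1 / 2 : ℝ) * B ^ (1 / 2 : ℝ) * ENNReal.ofReal (u ^ (-(1 / 2) : ℝ)) := by
    calc ‖dilationPairing g f u‖ₑ ≤ ∫⁻ x, ‖g x * f (u * x)‖ₑ := enorm_integral_le_lintegral_enorm _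
      _ = ∫⁻ x, ((fun x => ‖g x‖ₑ) * (fun x => ‖f (u * x)‖ₑ)) x := by
        simp_rw [enorm_mul, Pi.mul_apply]
      _ ≤ A ^ (1 / 2 : ℝ) * (∫⁻ x, ‖f (u * x)‖ₑ ^ (2 : ℝ)) ^ (1 / 2 : ℝ) :=
        ENNReal.lintegral_mul_le_Lp_mul_Lq volume Real.HolderConjugate.two_two
          hg.enorm.aemeasurable (hf.comp (measurable_const_mul u)).enorm.aemeasurable
      _ = _ := by
        rw [lintegral_dilate (fun y => ‖f y‖ₑ ^ (2 : ℝ)) (hf.enorm.pow_const _) hu,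
          ENNReal.mul_rpow_of_nonneg _ _ (by norm_num), ENNReal.ofReal_rpow_of_pos (by positivity),
          ← Real.rpow_neg_one u, ← Real.rpow_mul hu.le]
        rw [show (-1 * (1 / 2) : ℝ) = -(1 / 2) by norm_num, mul_left_comm, mul_comm]
  have h2 := ENNReal.toReal_mono (ENNReal.mul_ne_top (ENNReal.mul_ne_top hA' hB')
    ENNReal.ofReal_ne_top) h1
  rwa [toReal_enorm, ENNReal.toReal_mul, ENNReal.toReal_ofReal (by positivity)] at h2

theorem L2R.inner_eq (g h : L2R) : inner ℂ g h = ∫ x, (starRingEnd ℂ) (g x) * h x := by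
  rw [L2.inner_def]
  refine integral_congr_ae (Eventually.of_forall fun x => ?_)
  simp only [RCLike.inner_apply]
  ring

theorem L2R.measurable_conj (g : L2R) : Measurable fun x => (starRingEnd ℂ) (g x) :=
  Complex.continuous_conj.measurable.comp g.measurable

theorem L2R.memLp_conj (g : L2R) : MemLp (fun x => (starRingEnd ℂ) (g x)) 2 volume :=
  (Lp.memLp g).star

/-- The weak form of the definition of a Hausdorff operator. -/
theorem IsHausdorffOperator.integral_mul {K : ℝ → ℂ} {T : L2R →L[ℂ] L2R}
    (hT : IsHausdorffOperator K T) (hK : IsHausdorffKernel K) (f : L2R) {g : ℝ → ℂ}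
    (hg : Measurable g) (hg2 : MemLp g 2 volume) :
    ∫ x, g x * T f x = ∫ u, K u * dilationPairing g f u := by
  have hm : Measurable fun p : ℝ × ℝ => K p.2 * f (p.2 * p.1) :=
    (hK.measurable.comp measurable_snd).mul (f.measurable.comp (measurable_snd.mul measurable_fst))
  have hm' : Measurable fun p : ℝ × ℝ => g p.1 * (K p.2 * f (p.2 * p.1)) :=
    (hg.comp measurable_fst).mul hm
  have hm2 : Measurable fun x : ℝ => ∫⁻ u, ‖K u * f (u * x)‖ₑ := hm.enorm.lintegral_prod_right'
  have hint : Integrable (fun p : ℝ × ℝ => g p.1 * (K p.2 * f (p.2 * p.1)))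
      (volume.prod volume) := by
    refine ⟨hm'.aestronglyMeasurable, ?_⟩
    rw [HasFiniteIntegral, lintegral_prod _ hm'.enorm.aemeasurable]
    calc ∫⁻ x, ∫⁻ u, ‖g x * (K u * f (u * x))‖ₑ
        = ∫⁻ x, ((fun x => ‖g x‖ₑ) * fun x => ∫⁻ u, ‖K u * f (u * x)‖ₑ) x := by
          refine lintegral_congr fun x => ?_
          rw [Pi.mul_apply, ← lintegral_const_mul' _ _ enorm_ne_top]
          exact lintegral_congr fun u => enorm_mul _ _
      _ ≤ _ := ENNReal.lintegral_mul_le_Lp_mul_Lq volume Real.HolderConjugate.two_two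
          hg.enorm.aemeasurable hm2.aemeasurable
      _ < ⊤ := ENNReal.mul_lt_top
          (ENNReal.rpow_lt_top_of_nonneg (by norm_num) (lintegral_sq_ne_top hg2))
          (ENNReal.rpow_lt_top_of_nonneg (by norm_num) ((hK.lintegral_le f.measurable).trans_lt
            (ENNReal.mul_lt_top (ENNReal.rpow_lt_top_of_nonneg (by norm_num) hK.lintegral_ne_top)
            (lintegral_sq_ne_top (Lp.memLp f)).lt_top)).ne)
  calc ∫ x, g x * T f x = ∫ x, ∫ u, g x * (K u * f (u * x)) := by
        refine integral_congr_ae ?_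
        filter_upwards [hT f] with x hx
        rw [hx.2, ← integral_const_mul]
    _ = ∫ u, ∫ x, g x * (K u * f (u * x)) := integral_integral_swap hint
    _ = _ := by
        refine integral_congr_ae (Eventually.of_forall fun u => ?_)
        simp only [dilationPairing]
        rw [← integral_const_mul]
        exact integral_congr_ae (Eventually.of_forall fun x => by ring)

theorem memLp_comp_mul {g : ℝ → ℂ} (hg : Measurable g) (hg2 : MemLp g 2 volume) {a : ℝ}
    (ha : a ≠ 0) : MemLp (fun x => g (a * x)) 2 volume := by
  have h := Real.map_volume_mul_left ha
  refine (memLp_map_measure_iff (f := fun x => a * x) (g := g) hg.aestronglyMeasurable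
    (measurable_const_mul a).aemeasurable).1 ?_
  rw [h]
  exact hg2.smul_measure ENNReal.ofReal_ne_top

/-- The substitution `x ↦ x/u` moves the dilation from `T f` to `g`; the weak form then applies, and
the dilation is moved back. -/
theorem IsHausdorffOperator.dilationPairing_apply {K : ℝ → ℂ} {T : L2R →L[ℂ] L2R}
    (hT : IsHausdorffOperator K T) (hK : IsHausdorffKernel K) (f : L2R) {g : ℝ → ℂ}
    (hg : Measurable g) (hg2 : MemLp g 2 volume) {u : ℝ} (hu : 0 < u) :
    dilationPairing g (T f) u = ∫ v, K v * dilationPairing g f (u * v) := by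
  have h1 : dilationPairing g (T f) u = (u⁻¹ : ℝ) • ∫ x, g (u⁻¹ * x) * T f x := by
    have := Measure.integral_comp_mul_left (fun x => g (u⁻¹ * x) * T f x) u
    rw [abs_of_pos (inv_pos.2 hu)] at this
    rw [← this]
    refine integral_congr_ae (Eventually.of_forall fun x => ?_)
    simp only [inv_mul_cancel_left₀ hu.ne']
  have h2 : ∀ v, dilationPairing (fun x => g (u⁻¹ * x)) f v = u • dilationPairing g f (u * v) := by
    intro v
    have := Measure.integral_comp_mul_left (fun x => g x * f (u * v * x)) u⁻¹
    rw [inv_inv, abs_of_pos hu] at this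
    rw [dilationPairing, dilationPairing, ← this]
    refine integral_congr_ae (Eventually.of_forall fun x => ?_)
    simp only
    congr 2
    field_simp
  have hgu : Measurable fun x => g (u⁻¹ * x) := hg.comp (measurable_const_mul u⁻¹)
  rw [h1, hT.integral_mul hK f hgu
    (memLp_comp_mul hg hg2 (inv_ne_zero hu.ne')), ← integral_smul]
  refine integral_congr_ae (Eventually.of_forall fun v => ?_)
  simp only [h2, Complex.real_smul, Complex.ofReal_inv]
  have : (u : ℂ) ≠ 0 := by exact_mod_cast hu.ne'
  field_simp

theorem IsHausdorffOperator.integral_mul_comp {K L : ℝ → ℂ} {S T : L2R →L[ℂ] L2R}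
    (hS : IsHausdorffOperator K S) (hK : IsHausdorffKernel K)
    (hT : IsHausdorffOperator L T) (hL : IsHausdorffKernel L) (f : L2R) {g : ℝ → ℂ}
    (hg : Measurable g) (hg2 : MemLp g 2 volume) :
    ∫ x, g x * S (T f) x = ∫ u, K u * ∫ v, L v * dilationPairing g f (u * v) := by
  rw [hS.integral_mul hK _ hg hg2]
  refine integral_congr_ae (Eventually.of_forall fun u => ?_)
  rcases le_or_gt u 0 with h | h0
  · simp [hK.zero_of_nonpos u h]
  · simp only [hT.dilationPairing_apply hL f hg hg2 h0]

theorem L2R.operator_ext {S T : L2R →L[ℂ] L2R}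
    (h : ∀ f g : L2R, inner ℂ g (S f) = inner ℂ g (T f)) : S = T := by
  ext1 f
  exact ext_inner_left ℂ fun g => h f g

/-- Both products have the matrix coefficient `∫∫ K(u) L(v) P(uv) du dv`, which is symmetric. The
double integral converges absolutely because the bound `(uv)^{-1/2}` on `P` is a product. -/
theorem IsHausdorffOperator.commute {K L : ℝ → ℂ} {S T : L2R →L[ℂ] L2R}
    (hS : IsHausdorffOperator K S) (hK : IsHausdorffKernel K)
    (hT : IsHausdorffOperator L T) (hL : IsHausdorffKernel L) : S * T = T * S := by
  refine L2R.operator_ext fun f g => ?_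
  rw [L2R.inner_eq, L2R.inner_eq]
  simp only [mul_apply_eq_comp]
  have hg := g.measurable_conj
  have hg2 := g.memLp_conj
  rw [hS.integral_mul_comp hK hT hL f hg hg2, hT.integral_mul_comp hL hS hK f hg hg2]
  set P := dilationPairing (fun x => (starRingEnd ℂ) (g x)) f with hP
  have hPm : Measurable P := measurable_dilationPairing hg f.measurable
  obtain ⟨C, hC⟩ := exists_norm_dilationPairing_le hg f.measurable hg2 (Lp.memLp f)
  have hint : Integrable (fun p : ℝ × ℝ => K p.1 * (L p.2 * P (p.1 * p.2)))
      (volume.prod volume) := by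
    refine ((hK.integrable.norm.mul_prod hL.integrable.norm).const_mul C).mono' ?_
      (Eventually.of_forall fun p => ?_)
    · exact ((hK.measurable.comp measurable_fst).mul ((hL.measurable.comp measurable_snd).mul
        (hPm.comp (measurable_fst.mul measurable_snd)))).aestronglyMeasurable
    · obtain ⟨u, v⟩ := p
      simp only
      rcases le_or_gt u 0 with h | hu
      · simp [hK.zero_of_nonpos u h]
      rcases le_or_gt v 0 with h | hv
      · simp [hL.zero_of_nonpos v h]
      have := hC (u * v) (mul_pos hu hv)
      rw [Real.mul_rpow hu.le hv.le] at this
      simp only [norm_mul, Complex.norm_real]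
      rw [Real.norm_of_nonneg (Real.rpow_nonneg hu.le _),
        Real.norm_of_nonneg (Real.rpow_nonneg hv.le _)]
      calc ‖K u‖ * (‖L v‖ * ‖P (u * v)‖) ≤
            ‖K u‖ * (‖L v‖ * (C * (u ^ (-(1 / 2) : ℝ) * v ^ (-(1 / 2) : ℝ)))) := by gcongr
        _ = _ := by ring
  calc ∫ u, K u * ∫ v, L v * P (u * v) = ∫ u, ∫ v, K u * (L v * P (u * v)) := by
        simp_rw [integral_const_mul]
    _ = ∫ v, ∫ u, K u * (L v * P (u * v)) := integral_integral_swap hint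
    _ = _ := by
        refine integral_congr_ae (Eventually.of_forall fun v => ?_)
        simp only
        rw [← integral_const_mul]
        refine integral_congr_ae (Eventually.of_forall fun u => ?_)
        simp only
        rw [mul_comm u v]
        ring

/-! ### The Cesàro operator as a Hausdorff operator, and the resolvent equation for kernels -/

theorem integrableOn_Ioc_rpow {a : ℝ} (ha : -1 < a) (u : ℝ) (hu : 0 ≤ u) :
    IntegrableOn (fun s : ℝ => s ^ a) (Ioc 0 u) := by
  have h := intervalIntegral.intervalIntegrable_rpow' (a := 0) (b := u) ha
  rwa [intervalIntegrable_iff_integrableOn_Ioc_of_le hu] at h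

/-- A kernel carried by a subset of the half line and dominated there by a power. -/
theorem isHausdorffKernel_indicator {S : Set ℝ} (hS : MeasurableSet S) (hS0 : S ⊆ Ioi 0)
    {k : ℝ → ℂ} (hk : Measurable k) {C q : ℝ} (hC : ∀ u ∈ S, ‖k u‖ ≤ C * u ^ q)
    (hq : IntegrableOn (fun u : ℝ => u ^ (q - 1 / 2)) S) :
    IsHausdorffKernel (S.indicator k) where
  measurable := hk.indicator hS
  zero_of_nonpos u hu := indicator_of_notMem (fun h => (not_lt.2 hu) (hS0 h)) _
  integrableOn := by
    refine Integrable.integrableOn ?_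
    have : (fun u : ℝ => S.indicator k u * ((u ^ (-(1 / 2) : ℝ) : ℝ) : ℂ)) =
        S.indicator fun u => k u * ((u ^ (-(1 / 2) : ℝ) : ℝ) : ℂ) := by
      ext u
      by_cases hu : u ∈ S <;> simp [hu]
    rw [this, integrable_indicator_iff hS]
    refine (hq.const_mul C).mono' (by fun_prop) ?_
    filter_upwards [ae_restrict_mem hS] with u hu
    have h0 : 0 < u := hS0 hu
    rw [norm_mul, Complex.norm_real, Real.norm_of_nonneg (by positivity), sub_eq_add_neg,
      Real.rpow_add h0, ← mul_assoc]
    exact mul_le_mul_of_nonneg_right (hC u hu) (by positivity)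

/-- The kernel of the Cesàro operator. -/
noncomputable def cesaroKernel : ℝ → ℂ := (Ioc (0 : ℝ) 1).indicator fun _ => 1

theorem isHausdorffKernel_cesaroKernel : IsHausdorffKernel cesaroKernel :=
  isHausdorffKernel_indicator measurableSet_Ioc Ioc_subset_Ioi_self measurable_const
    (C := 1) (q := 0) (fun u _ => by simp) (integrableOn_Ioc_rpow (by norm_num) 1 zero_le_one)

theorem integral_cesaroKernel_mul (φ : ℝ → ℂ) :
    ∫ u, cesaroKernel u * φ u = ∫ u in (0 : ℝ)..1, φ u := by
  rw [intervalIntegral.integral_of_le zero_le_one, ← integral_indicator measurableSet_Ioc]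
  refine integral_congr_ae (Eventually.of_forall fun u => ?_)
  by_cases hu : u ∈ Ioc (0 : ℝ) 1 <;> simp [cesaroKernel, hu]

theorem isHausdorffOperator_cesaro : IsHausdorffOperator cesaroKernel cesaro := by
  intro f
  filter_upwards [isHausdorffKernel_cesaroKernel.ae_integrable f, cesaro_apply_ae f, ae_ne_zero]
    with x h1 h2 h3
  exact ⟨h1, by rw [h2, cesaroMean_eq _ h3, integral_cesaroKernel_mul]⟩

/-- Fubini's theorem on the triangle `0 < s ≤ u`, for the averages of a function that is
`O(u^{-1/2})`. -/
theorem IsHausdorffKernel.integral_mul_average {K : ℝ → ℂ} (hK : IsHausdorffKernel K)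
    {P : ℝ → ℂ} (hP : Measurable P) {C : ℝ}
    (hC : ∀ u : ℝ, 0 < u → ‖P u‖ ≤ C * u ^ (-(1 / 2) : ℝ)) :
    ∫ u, K u * ∫ v, cesaroKernel v * P (u * v) =
      ∫ s in Ioi (0 : ℝ), (∫ u in Ioi s, K u / u) * P s := by
  set A : Set (ℝ × ℝ) := {p | 0 < p.2 ∧ p.2 ≤ p.1} with hA
  have hAm : MeasurableSet A :=
    (measurableSet_lt measurable_const measurable_snd).inter
      (measurableSet_le measurable_snd measurable_fst)
  set Φ : ℝ × ℝ → ℂ := A.indicator fun p => K p.1 / p.1 * P p.2 with hΦ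
  have hΦm : Measurable Φ :=
    (((hK.measurable.comp measurable_fst).div (by fun_prop)).mul
      (hP.comp measurable_snd)).indicator hAm
  have hΦ1 : ∀ u s, Φ (u, s) = (Ioc 0 u).indicator (fun s => K u / u * P s) s := by
    intro u s
    simp only [hΦ, indicator_apply, hA, mem_ofPred_eq, mem_Ioc]
  have hPi : ∀ u : ℝ, 0 < u → IntegrableOn P (Ioc 0 u) := by
    intro u hu
    refine ((integrableOn_Ioc_rpow (a := -(1 / 2)) (by norm_num) u hu.le).const_mul C).mono'
      hP.aestronglyMeasurable ?_
    filter_upwards [ae_restrict_mem measurableSet_Ioc] with s hs using hC s hs.1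
  have hPn : ∀ u : ℝ, 0 < u → ∫ s in Ioc 0 u, ‖P s‖ ≤ 2 * C * u ^ (1 / 2 : ℝ) := by
    intro u hu
    calc ∫ s in Ioc 0 u, ‖P s‖ ≤ ∫ s in Ioc 0 u, C * s ^ (-(1 / 2) : ℝ) :=
          setIntegral_mono_on (hPi u hu).norm
            ((integrableOn_Ioc_rpow (a := -(1 / 2)) (by norm_num) u hu.le).const_mul C)
            measurableSet_Ioc fun s hs => hC s hs.1
      _ = _ := by
          rw [integral_const_mul, ← intervalIntegral.integral_of_le hu.le,
            integral_rpow (Or.inl (by norm_num)), Real.zero_rpow (by norm_num)]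
          norm_num
          ring
  have hneg : ∀ u : ℝ, u ≤ 0 → ∀ s, Φ (u, s) = 0 := fun u hu s => by
    rw [hΦ1, Ioc_eq_empty (not_lt.2 hu), indicator_empty]
  have hint : Integrable Φ (volume.prod volume) := by
    rw [integrable_prod_iff hΦm.aestronglyMeasurable]
    refine ⟨Eventually.of_forall fun u => ?_, ?_⟩
    · rcases le_or_gt u 0 with h | hu
      · simp [hneg u h]
      · simp only [hΦ1]
        rw [integrable_indicator_iff measurableSet_Ioc]
        exact (hPi u hu).const_mul _
    · refine (hK.integrable.norm.const_mul (2 * C)).mono'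
        hΦm.norm.aestronglyMeasurable.integral_prod_right' (Eventually.of_forall fun u => ?_)
      rcases le_or_gt u 0 with h | hu
      · simp [hneg u h, hK.zero_of_nonpos u h]
      · rw [Real.norm_of_nonneg (integral_nonneg fun s => norm_nonneg _)]
        simp only [hΦ1, norm_indicator_eq_indicator_norm]
        rw [integral_indicator measurableSet_Ioc]
        simp only [norm_mul, norm_div, Complex.norm_real]
        rw [integral_const_mul, Real.norm_of_nonneg hu.le, Real.norm_of_nonneg (by positivity)]
        calc ‖K u‖ / u * ∫ s in Ioc 0 u, ‖P s‖ ≤ ‖K u‖ / u * (2 * C * u ^ (1 / 2 : ℝ)) := by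
              gcongr
              exact hPn u hu
          _ = _ := by
              rw [show (-(1 / 2) : ℝ) = 1 / 2 - 1 by norm_num, Real.rpow_sub_one hu.ne']
              ring
  calc ∫ u, K u * ∫ v, cesaroKernel v * P (u * v) = ∫ u, ∫ s, Φ (u, s) := by
        refine integral_congr_ae (Eventually.of_forall fun u => ?_)
        simp only
        rcases le_or_gt u 0 with h | hu
        · simp [hneg u h, hK.zero_of_nonpos u h]
        · simp only [hΦ1]
          rw [integral_indicator measurableSet_Ioc, integral_const_mul, integral_cesaroKernel_mul,
            intervalIntegral.integral_comp_mul_left P hu.ne', mul_zero, mul_one,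
            intervalIntegral.integral_of_le hu.le, Complex.real_smul, Complex.ofReal_inv]
          ring
    _ = ∫ s, ∫ u, Φ (u, s) := integral_integral_swap hint
    _ = _ := by
        rw [← integral_indicator measurableSet_Ioi]
        refine integral_congr_ae (Eventually.of_forall fun s => ?_)
        simp only
        by_cases hs : 0 < s
        -- The slice of the triangle at height `s` is the closed half line `u ≥ s`; its endpoint is
        -- a null set.
        · rw [indicator_of_mem (mem_Ioi.2 hs), ← integral_mul_const, ← integral_Ici_eq_integral_Ioi,
            ← integral_indicator measurableSet_Ici]
          refine integral_congr_ae (Eventually.of_forall fun u => ?_)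
          simp [hΦ, hA, indicator_apply, hs]
        · rw [indicator_of_notMem (by simpa using hs)]
          refine integral_eq_zero_of_ae (Eventually.of_forall fun u => ?_)
          simp [hΦ, hA, hs]

/-- By `integral_mul_average`, `S 𝒞` acts weakly through the kernel `s ↦ ∫_s^∞ K(u)/u du`, so the
hypothesis `hw` is the operator identity read on kernels. -/
theorem IsHausdorffOperator.smul_mul_cesaro {K : ℝ → ℂ} {S : L2R →L[ℂ] L2R}
    (hS : IsHausdorffOperator K S) (hK : IsHausdorffKernel K) {w : ℂ}
    (hw : ∀ s : ℝ, 0 < s → w * ∫ u in Ioi s, K u / u = K s - cesaroKernel s) :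
    w • (S * cesaro) = S - cesaro := by
  refine L2R.operator_ext fun f g => ?_
  have hg := g.measurable_conj
  have hg2 := g.memLp_conj
  have hPm : Measurable (dilationPairing (fun x => (starRingEnd ℂ) (g x)) f) :=
    measurable_dilationPairing hg f.measurable
  obtain ⟨C, hC⟩ := exists_norm_dilationPairing_le hg f.measurable hg2 (Lp.memLp f)
  have h0 := isHausdorffKernel_cesaroKernel
  rw [smul_apply, sub_apply, inner_smul_right,
    inner_sub_right, mul_apply_eq_comp, L2R.inner_eq, L2R.inner_eq, L2R.inner_eq,
    hS.integral_mul_comp hK isHausdorffOperator_cesaro h0 f hg hg2, hS.integral_mul hK f hg hg2,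
    isHausdorffOperator_cesaro.integral_mul h0 f hg hg2, hK.integral_mul_average hPm hC,
    ← integral_sub (hK.integrable_mul hPm.aestronglyMeasurable hC)
      (h0.integrable_mul hPm.aestronglyMeasurable hC), ← integral_const_mul]
  simp only [← sub_mul]
  rw [integral_eq_setIntegral_Ioi (K := fun u => K u - cesaroKernel u)
    (fun u hu => by simp [hK.zero_of_nonpos u hu, h0.zero_of_nonpos u hu])]
  refine setIntegral_congr_fun measurableSet_Ioi fun s hs => ?_
  rw [← mul_assoc, hw s hs]

/-- Expanding, `(l - 𝒞)(l⁻¹ + l⁻² S) = 1 + l⁻¹ (S - 𝒞 - l⁻¹ 𝒞 S)`, and the bracket vanishes by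
`smul_mul_cesaro` and commutativity. Commutativity also makes this right inverse a left inverse. -/
theorem resolvent_cesaro_of_isHausdorffOperator {K : ℝ → ℂ} {S : L2R →L[ℂ] L2R}
    (hS : IsHausdorffOperator K S) (hK : IsHausdorffKernel K) {l : ℂ} (hl : l ≠ 0)
    (hw : ∀ s : ℝ, 0 < s → l⁻¹ * ∫ u in Ioi s, K u / u = K s - cesaroKernel s) :
    l ∈ resolventSet ℂ cesaro ∧ resolvent cesaro l = l⁻¹ • 1 + (l⁻¹ ^ 2) • S := by
  have h1 := hS.smul_mul_cesaro hK hw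
  have h2 := hS.commute hK isHausdorffOperator_cesaro isHausdorffKernel_cesaroKernel
  have e1 : (algebraMap ℂ (L2R →L[ℂ] L2R) l - cesaro) * (l⁻¹ • 1 + (l⁻¹ ^ 2) • S) = 1 := by
    have : (algebraMap ℂ (L2R →L[ℂ] L2R) l - cesaro) * (l⁻¹ • 1 + (l⁻¹ ^ 2) • S) =
        (l * l⁻¹) • 1 + (l * l⁻¹ * l⁻¹) • S - l⁻¹ • cesaro
          - l⁻¹ • (l⁻¹ • (cesaro * S)) := by
      rw [Algebra.algebraMap_eq_smul_one]
      simp only [sub_mul, mul_add, smul_mul_assoc, mul_smul_comm, one_mul, mul_one, smul_smul]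
      module
    rw [this, ← h2, h1, mul_inv_cancel₀ hl]
    module
  have e2 : (l⁻¹ • 1 + (l⁻¹ ^ 2) • S) * (algebraMap ℂ (L2R →L[ℂ] L2R) l - cesaro) = 1 := by
    refine Eq.trans ?_ e1
    rw [Algebra.algebraMap_eq_smul_one]
    simp only [sub_mul, mul_add, add_mul, mul_sub, smul_mul_assoc, mul_smul_comm, one_mul, mul_one,
      h2]
    module
  refine ⟨spectrum.mem_resolventSet_of_left_right_inverse e1 e2, ?_⟩
  exact Ring.inverse_unit (⟨_, _, e1, e2⟩ : (L2R →L[ℂ] L2R)ˣ)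

/-! ### Inversion of circles around `1`, power kernels and the resolvent -/

theorem norm_ofReal_cpow_neg {u : ℝ} (hu : 0 < u) (w : ℂ) : ‖(u : ℂ) ^ (-w)‖ = u ^ (-w.re) := by
  rw [Complex.norm_cpow_eq_rpow_re_of_pos hu, Complex.neg_re]

theorem sq_norm_sub_one (l : ℂ) : ‖l‖ ^ 2 = ‖l - 1‖ ^ 2 - 1 + 2 * l.re := by
  rw [Complex.sq_norm, Complex.sq_norm, Complex.normSq_apply, Complex.normSq_apply]
  simp
  ring

/-- Inversion maps the circle of radius `ρ > 1` about `1` to a circle whose rightmost point is the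
image of `1 + ρ`. The bound depends on `ρ` alone, which gives one integrable majorant for the powers
`u^{-1/λ}` along a whole contour. -/
theorem inv_re_le_of_norm_sub_one {l : ℂ} (h : 1 < ‖l - 1‖) :
    l⁻¹.re ≤ 1 / (1 + ‖l - 1‖) := by
  have h1 := sq_norm_sub_one l
  have h2 : l.re ≤ 1 + ‖l - 1‖ := by
    have := Complex.re_le_norm (l - 1)
    rw [Complex.sub_re, Complex.one_re] at this
    linarith
  have h0 : l ≠ 0 := by
    rintro rfl
    simp at h
  have h3 : 0 < ‖l‖ ^ 2 := by positivity
  rw [Complex.inv_re, ← Complex.sq_norm, div_le_div_iff₀ h3 (by linarith), h1]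
  nlinarith

/-- For radius `ρ < 1` the image of `1 + ρ` is instead the leftmost point of the inverted circle. -/
theorem le_inv_re_of_norm_sub_one {l : ℂ} (h : ‖l - 1‖ < 1) :
    1 / (1 + ‖l - 1‖) ≤ l⁻¹.re := by
  have h1 := sq_norm_sub_one l
  have h2 : l.re ≤ 1 + ‖l - 1‖ := by
    have := Complex.re_le_norm (l - 1)
    rw [Complex.sub_re, Complex.one_re] at this
    linarith
  have h0 : l ≠ 0 := by
    rintro rfl
    simp at h
  have h3 : 0 < ‖l‖ ^ 2 := by positivity
  have h4 := norm_nonneg (l - 1)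
  rw [Complex.inv_re, ← Complex.sq_norm, div_le_div_iff₀ (by linarith) h3, h1]
  nlinarith

theorem integrableOn_Ioi_one_rpow {a : ℝ} (ha : a < -1) :
    IntegrableOn (fun u : ℝ => u ^ a) (Ioi 1) := integrableOn_Ioi_rpow_of_lt ha one_pos

/-- The kernel `u^{-w}` on `(0, 1]`. -/
noncomputable def innerPowerKernel (w : ℂ) : ℝ → ℂ :=
  (Ioc (0 : ℝ) 1).indicator fun u => (u : ℂ) ^ (-w)

/-- The kernel `-u^{-w}` on `(1, ∞)`. -/
noncomputable def outerPowerKernel (w : ℂ) : ℝ → ℂ :=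
  (Ioi (1 : ℝ)).indicator fun u => -(u : ℂ) ^ (-w)

theorem isHausdorffKernel_innerPowerKernel {w : ℂ} (hw : w.re < 1 / 2) :
    IsHausdorffKernel (innerPowerKernel w) :=
  isHausdorffKernel_indicator measurableSet_Ioc Ioc_subset_Ioi_self (by fun_prop)
    (C := 1) (q := -w.re) (fun u hu => by rw [norm_ofReal_cpow_neg hu.1, one_mul])
    (integrableOn_Ioc_rpow (by linarith) 1 zero_le_one)

theorem isHausdorffKernel_outerPowerKernel {w : ℂ} (hw : 1 / 2 < w.re) :
    IsHausdorffKernel (outerPowerKernel w) :=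
  isHausdorffKernel_indicator measurableSet_Ioi (Ioi_subset_Ioi zero_le_one) (by fun_prop)
    (C := 1) (q := -w.re)
    (fun u hu => by rw [norm_neg, norm_ofReal_cpow_neg (one_pos.trans hu), one_mul])
    (integrableOn_Ioi_one_rpow (by linarith))

theorem ofReal_cpow_neg_div {u : ℝ} (hu : 0 < u) (w : ℂ) :
    (u : ℂ) ^ (-w) / u = (u : ℂ) ^ (-w - 1) := by
  have : (u : ℂ) ≠ 0 := by exact_mod_cast hu.ne'
  rw [Complex.cpow_sub _ _ this, Complex.cpow_one]

/-- For `s ≤ 1`, `w ∫_s^1 u^{-w-1} du = s^{-w} - 1`; for `s > 1` both sides vanish. -/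
theorem mul_integral_innerPowerKernel {w : ℂ} (hw : w ≠ 0) {s : ℝ} (hs : 0 < s) :
    w * ∫ u in Ioi s, innerPowerKernel w u / u = innerPowerKernel w s - cesaroKernel s := by
  have h1 : ∀ u : ℝ, innerPowerKernel w u / u =
      (Ioc (0 : ℝ) 1).indicator (fun u : ℝ => (u : ℂ) ^ (-w - 1)) u := by
    intro u
    by_cases hu : u ∈ Ioc (0 : ℝ) 1
    · simp only [innerPowerKernel, indicator_of_mem hu, ofReal_cpow_neg_div hu.1]
    · simp only [innerPowerKernel, indicator_of_notMem hu, zero_div]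
  simp_rw [h1]
  rw [setIntegral_indicator measurableSet_Ioc]
  have h2 : Ioi s ∩ Ioc 0 1 = Ioc s 1 := by
    ext u
    simp only [mem_inter_iff, mem_Ioi, mem_Ioc]
    exact ⟨fun h => ⟨h.1, h.2.2⟩, fun h => ⟨h.1, hs.trans h.1, h.2⟩⟩
  rw [h2]
  rcases le_or_gt s 1 with h | h
  · have hmem : s ∈ Ioc (0 : ℝ) 1 := ⟨hs, h⟩
    rw [← intervalIntegral.integral_of_le h, integral_cpow (Or.inr ⟨?_, ?_⟩), innerPowerKernel,
      cesaroKernel, indicator_of_mem hmem, indicator_of_mem hmem]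
    · simp only [sub_add_cancel, Complex.ofReal_one, Complex.one_cpow]
      field_simp
      ring
    · intro h
      exact hw (by linear_combination -h)
    · rw [uIcc_of_le h]
      exact fun h => (not_le.2 hs) h.1
  · have hmem : s ∉ Ioc (0 : ℝ) 1 := fun h' => (not_le.2 h) h'.2
    rw [Ioc_eq_empty (by linarith), innerPowerKernel, cesaroKernel, indicator_of_notMem hmem,
      indicator_of_notMem hmem]
    simp

/-- The left side is `-max(s, 1)^{-w}`: it equals `-1` for `s ≤ 1`, which is minus the Cesàro
kernel, and `-s^{-w}` for `s > 1`. -/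
theorem mul_integral_outerPowerKernel {w : ℂ} (hw : 0 < w.re) {s : ℝ} (hs : 0 < s) :
    w * ∫ u in Ioi s, outerPowerKernel w u / u = outerPowerKernel w s - cesaroKernel s := by
  have hw0 : w ≠ 0 := by
    rintro rfl
    simp at hw
  have h1 : ∀ u : ℝ, outerPowerKernel w u / u =
      (Ioi (1 : ℝ)).indicator (fun u : ℝ => -(u : ℂ) ^ (-w - 1)) u := by
    intro u
    by_cases hu : u ∈ Ioi (1 : ℝ)
    · simp only [outerPowerKernel, indicator_of_mem hu, neg_div,
        ofReal_cpow_neg_div (one_pos.trans hu)]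
    · simp only [outerPowerKernel, indicator_of_notMem hu, zero_div]
  simp_rw [h1]
  rw [setIntegral_indicator measurableSet_Ioi, Ioi_inter_Ioi, integral_neg,
    integral_Ioi_cpow_of_lt (by rw [Complex.sub_re, Complex.neg_re, Complex.one_re]; linarith)
      (by positivity)]
  simp only [sub_add_cancel]
  rcases le_or_gt s 1 with h | h
  · rw [sup_of_le_right h, outerPowerKernel, cesaroKernel, indicator_of_notMem (by simpa using h),
      indicator_of_mem (show s ∈ Ioc (0 : ℝ) 1 from ⟨hs, h⟩)]
    simp [hw0]
  · rw [sup_of_le_left h.le, outerPowerKernel, cesaroKernel, indicator_of_mem (mem_Ioi.2 h),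
      indicator_of_notMem (fun h' : s ∈ Ioc (0 : ℝ) 1 => (not_le.2 h) h'.2)]
    field_simp
    simp

theorem inv_re_lt_half {l : ℂ} (h : 1 < ‖l - 1‖) : l⁻¹.re < 1 / 2 :=
  (inv_re_le_of_norm_sub_one h).trans_lt (one_div_lt_one_div_of_lt two_pos (by linarith))

theorem half_lt_inv_re {l : ℂ} (h : ‖l - 1‖ < 1) : 1 / 2 < l⁻¹.re :=
  (one_div_lt_one_div_of_lt (by positivity) (by linarith)).trans_le (le_inv_re_of_norm_sub_one h)

theorem ne_zero_of_norm_sub_one_ne {l : ℂ} (h : ‖l - 1‖ ≠ 1) : l ≠ 0 := by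
  rintro rfl
  simp at h

theorem resolvent_cesaro_of_one_lt {l : ℂ} (h : 1 < ‖l - 1‖) :
    l ∈ resolventSet ℂ cesaro ∧ resolvent cesaro l = l⁻¹ • 1 +
      (l⁻¹ ^ 2) • (isHausdorffKernel_innerPowerKernel (inv_re_lt_half h)).operator :=
  resolvent_cesaro_of_isHausdorffOperator (IsHausdorffKernel.isHausdorffOperator _)
    (isHausdorffKernel_innerPowerKernel (inv_re_lt_half h)) (ne_zero_of_norm_sub_one_ne h.ne')
    fun _ hs => mul_integral_innerPowerKernel (inv_ne_zero (ne_zero_of_norm_sub_one_ne h.ne')) hs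

theorem resolvent_cesaro_of_lt_one {l : ℂ} (h : ‖l - 1‖ < 1) :
    l ∈ resolventSet ℂ cesaro ∧ resolvent cesaro l = l⁻¹ • 1 +
      (l⁻¹ ^ 2) • (isHausdorffKernel_outerPowerKernel (half_lt_inv_re h)).operator :=
  resolvent_cesaro_of_isHausdorffOperator (IsHausdorffKernel.isHausdorffOperator _)
    (isHausdorffKernel_outerPowerKernel (half_lt_inv_re h)) (ne_zero_of_norm_sub_one_ne h.ne)
    fun _ hs => mul_integral_outerPowerKernel (one_half_pos.trans (half_lt_inv_re h)) hs

/-! ### The spectrum of the Cesàro operator, by approximate eigenvectors -/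

theorem L2R.norm_sq (f : L2R) : ‖f‖ ^ 2 = ∫ x, ‖f x‖ ^ 2 := by
  have h : ∀ x, inner ℂ (f x) (f x) = ((‖f x‖ ^ 2 : ℝ) : ℂ) := fun x => by
    rw [inner_self_eq_norm_sq_to_K]
    norm_cast
  rw [← inner_self_eq_norm_sq (𝕜 := ℂ), L2.inner_def]
  simp only [h]
  rw [integral_complex_ofReal]
  exact Complex.ofReal_re _

theorem memLp_indicator_cpow {a : ℂ} (ha : -(1 / 2) < a.re) :
    MemLp ((Ioc (0 : ℝ) 1).indicator fun x => (x : ℂ) ^ a) 2 volume := by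
  have hm : Measurable fun x : ℝ => (x : ℂ) ^ a := by fun_prop
  rw [memLp_indicator_iff_restrict measurableSet_Ioc,
    memLp_two_iff_integrable_sq_norm hm.aestronglyMeasurable]
  refine (integrableOn_Ioc_rpow (a := a.re * 2) (by linarith) 1 zero_le_one).congr_fun ?_
    measurableSet_Ioc
  intro x hx
  simp only
  rw [Complex.norm_cpow_eq_rpow_re_of_pos hx.1, Real.rpow_mul hx.1.le, Real.rpow_two]

theorem memLp_indicator_inv :
    MemLp ((Ioi (1 : ℝ)).indicator fun x => (x : ℂ)⁻¹) 2 volume := by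
  have hm : Measurable fun x : ℝ => (x : ℂ)⁻¹ := by fun_prop
  rw [memLp_indicator_iff_restrict measurableSet_Ioi,
    memLp_two_iff_integrable_sq_norm hm.aestronglyMeasurable]
  refine (integrableOn_Ioi_one_rpow (a := -2) (by norm_num)).congr_fun ?_ measurableSet_Ioi
  intro x hx
  have : 0 < x := one_pos.trans hx
  simp only [norm_inv, Complex.norm_real, Real.norm_of_nonneg this.le]
  rw [Real.rpow_neg this.le, inv_pow, Real.rpow_two]

theorem norm_sq_toLp_cpow {a : ℂ} (ha : -(1 / 2) < a.re) :
    ‖(memLp_indicator_cpow ha).toLp _‖ ^ 2 = (2 * a.re + 1)⁻¹ := by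
  rw [L2R.norm_sq]
  calc ∫ x, ‖(memLp_indicator_cpow ha).toLp _ x‖ ^ 2
      = ∫ x, (Ioc (0 : ℝ) 1).indicator (fun x => x ^ (a.re * 2)) x := by
        refine integral_congr_ae ?_
        filter_upwards [MemLp.coeFn_toLp (memLp_indicator_cpow ha)] with x hx
        rw [hx]
        by_cases h : x ∈ Ioc (0 : ℝ) 1
        · rw [indicator_of_mem h, indicator_of_mem h, Complex.norm_cpow_eq_rpow_re_of_pos h.1,
            Real.rpow_mul h.1.le, Real.rpow_two]
        · rw [indicator_of_notMem h, indicator_of_notMem h]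
          simp
    _ = _ := by
        rw [integral_indicator measurableSet_Ioc, ← intervalIntegral.integral_of_le zero_le_one,
          integral_rpow (Or.inl (by linarith)), Real.one_rpow, Real.zero_rpow (by linarith)]
        rw [sub_zero, one_div, mul_comm]

/-- A power `x^a` is a formal eigenfunction of `𝒞`. Truncating it to `(0, 1]` leaves an error
proportional to the tail `1/x` on `(1, ∞)`, which does not depend on `a`. -/
theorem cesaro_toLp_cpow {a : ℂ} (ha : -(1 / 2) < a.re) :
    cesaro ((memLp_indicator_cpow ha).toLp _) =
      (a + 1)⁻¹ • (memLp_indicator_cpow ha).toLp _ + (a + 1)⁻¹ • memLp_indicator_inv.toLp _ := by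
  refine Lp.ext ?_
  have ha1 : a + 1 ≠ 0 := by
    intro h
    have := congrArg Complex.re h
    simp at this
    linarith
  set f := (memLp_indicator_cpow ha).toLp _
  set g := memLp_indicator_inv.toLp _
  filter_upwards [cesaro_apply_ae f, Lp.coeFn_add ((a + 1)⁻¹ • f) ((a + 1)⁻¹ • g),
    Lp.coeFn_smul (a + 1)⁻¹ f, Lp.coeFn_smul (a + 1)⁻¹ g,
    MemLp.coeFn_toLp (memLp_indicator_cpow ha), MemLp.coeFn_toLp memLp_indicator_inv, ae_ne_zero]
    with x h1 h2 h3 h4 h5 h6 h7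
  rw [h1, cesaroMean_congr (MemLp.coeFn_toLp (memLp_indicator_cpow ha)), h2, Pi.add_apply, h3, h4,
    Pi.smul_apply, Pi.smul_apply, h5, h6, cesaroMean]
  rcases h7.lt_or_gt with hx | hx
  · rw [indicator_of_notMem (fun h => (not_lt.2 hx.le) h.1),
      indicator_of_notMem (fun h : x ∈ Ioi (1 : ℝ) => by have : 1 < x := h; linarith),
      intervalIntegral.integral_of_ge hx.le, setIntegral_indicator measurableSet_Ioc]
    have : Ioc x 0 ∩ Ioc 0 1 = ∅ := by
      ext u
      simp only [mem_inter_iff, mem_Ioc, mem_empty_iff_false, iff_false]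
      rintro ⟨⟨_, h⟩, h', _⟩
      linarith
    rw [this]
    simp
  · have hx0 : (x : ℂ) ≠ 0 := by exact_mod_cast hx.ne'
    have hre : -1 < a.re := by linarith
    rw [intervalIntegral.integral_of_le hx.le, setIntegral_indicator measurableSet_Ioc,
      Ioc_inter_Ioc, sup_idem]
    rcases le_or_gt x 1 with h | h
    · rw [min_eq_left h, indicator_of_mem (show x ∈ Ioc (0 : ℝ) 1 from ⟨hx, h⟩),
        indicator_of_notMem (by simpa using h), ← intervalIntegral.integral_of_le hx.le,
        integral_cpow (Or.inl hre), Complex.ofReal_zero, Complex.zero_cpow ha1,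
        Complex.cpow_add _ _ hx0, Complex.cpow_one]
      simp only [smul_eq_mul]
      field_simp
      ring
    · rw [min_eq_right h.le, indicator_of_notMem (fun h' : x ∈ Ioc (0 : ℝ) 1 => not_le.2 h h'.2),
        indicator_of_mem (mem_Ioi.2 h), ← intervalIntegral.integral_of_le zero_le_one,
        integral_cpow (Or.inl hre), Complex.ofReal_zero, Complex.zero_cpow ha1,
        Complex.ofReal_one, Complex.one_cpow]
      simp only [smul_eq_mul]
      field_simp
      ring

/-- With exponents `a = z - 1 + 1/(n+1)` and `lₙ = (a + 1)⁻¹ → z⁻¹`, the truncated powers satisfy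
`(lₙ - 𝒞) fₙ = -lₙ g` with `g` fixed, while `‖fₙ‖² = (n+1)/2` is unbounded. If `z⁻¹` were in the
resolvent set, `fₙ = -lₙ (lₙ - 𝒞)⁻¹ g` would converge. -/
theorem inv_mem_spectrum_cesaro {z : ℂ} (hz : z.re = 1 / 2) : z⁻¹ ∈ spectrum ℂ cesaro := by
  intro hmem
  set g : L2R := memLp_indicator_inv.toLp _
  have hz0 : z ≠ 0 := by
    rintro rfl
    norm_num at hz
  have hpos : ∀ n : ℕ, (0 : ℝ) < 1 / ((n : ℝ) + 1) := fun n => by positivity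
  have ha : ∀ n : ℕ, -(1 / 2) < (z - 1 + ((1 / ((n : ℝ) + 1) : ℝ) : ℂ)).re := by
    intro n
    have := hpos n
    rw [Complex.add_re, Complex.sub_re, hz, Complex.ofReal_re, Complex.one_re]
    linarith
  set f : ℕ → L2R := fun n => (memLp_indicator_cpow (ha n)).toLp _ with hf
  set l : ℕ → ℂ := fun n => (z + ((1 / ((n : ℝ) + 1) : ℝ) : ℂ))⁻¹ with hl
  have hltend : Tendsto l atTop (𝓝 z⁻¹) := by
    have h1 : Tendsto (fun n : ℕ => z + ((1 / ((n : ℝ) + 1) : ℝ) : ℂ)) atTop (𝓝 (z + (0 : ℝ))) :=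
      tendsto_const_nhds.add
        ((Complex.continuous_ofReal.tendsto 0).comp tendsto_one_div_add_atTop_nhds_zero_nat)
    rw [Complex.ofReal_zero, add_zero] at h1
    exact h1.inv₀ hz0
  have hcf : ∀ n, cesaro (f n) = l n • f n + l n • g := by
    intro n
    have := cesaro_toLp_cpow (ha n)
    rwa [show z - 1 + ((1 / ((n : ℝ) + 1) : ℝ) : ℂ) + 1 = z + ((1 / ((n : ℝ) + 1) : ℝ) : ℂ) by
      ring] at this
  have hnorm : ∀ n, ‖f n‖ ^ 2 = ((n : ℝ) + 1) / 2 := by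
    intro n
    rw [hf, norm_sq_toLp_cpow (ha n), Complex.add_re, Complex.sub_re, hz, Complex.ofReal_re,
      Complex.one_re]
    field_simp
    ring
  have hcont : ContinuousAt (fun k : ℂ => ‖-(k • resolvent cesaro k g)‖ ^ 2) z⁻¹ := by
    have h1 : ContinuousAt (resolvent cesaro) z⁻¹ :=
      (spectrum.hasDerivAt_resolvent_const_left hmem).continuousAt
    exact ((continuousAt_id.smul (h1.clm_apply continuousAt_const)).neg.norm).pow 2
  have hev : ∀ᶠ n in atTop, ‖-(l n • resolvent cesaro (l n) g)‖ ^ 2 = ((n : ℝ) + 1) / 2 := by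
    filter_upwards [hltend.eventually ((spectrum.isOpen_resolventSet cesaro).mem_nhds hmem)]
      with n hn
    have h1 : (algebraMap ℂ (L2R →L[ℂ] L2R) (l n) - cesaro) (f n) = -(l n • g) := by
      rw [Algebra.algebraMap_eq_smul_one, sub_apply, hcf n, smul_apply,
        one_apply_eq_self]
      abel
    have h2 : resolvent cesaro (l n) * (algebraMap ℂ (L2R →L[ℂ] L2R) (l n) - cesaro) = 1 := by
      rw [spectrum.resolvent_eq hn]
      exact IsUnit.val_inv_mul hn
    have h3 : f n = -(l n • resolvent cesaro (l n) g) := by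
      rw [← map_smul, ← map_neg, ← h1, ← mul_apply_eq_comp, h2]
      rfl
    rw [← h3, hnorm]
  have hT : Tendsto (fun n : ℕ => ((n : ℝ) + 1) / 2) atTop atTop :=
    (tendsto_atTop_add_const_right _ _ tendsto_natCast_atTop_atTop).atTop_div_const two_pos
  exact not_tendsto_nhds_of_tendsto_atTop hT _ ((hcont.tendsto.comp hltend).congr' hev)

theorem inv_re_of_norm_sub_one_eq {l : ℂ} (hl : l ≠ 0) (h : ‖l - 1‖ = 1) : l⁻¹.re = 1 / 2 := by
  have h1 := sq_norm_sub_one l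
  have h3 : 0 < ‖l‖ ^ 2 := by positivity
  rw [Complex.inv_re, ← Complex.sq_norm, div_eq_div_iff h3.ne' two_ne_zero, h1, h]
  ring

theorem norm_inv_sub_one {z : ℂ} (hz : z.re = 1 / 2) : ‖z⁻¹ - 1‖ = 1 := by
  have hz0 : z ≠ 0 := by
    rintro rfl
    norm_num at hz
  have h2 : z⁻¹ - 1 = -(z - 1) / z := by
    field_simp
    ring
  have h3 := sq_norm_sub_one z
  rw [h2, norm_div, norm_neg, div_eq_one_iff_eq (norm_ne_zero_iff.2 hz0),
    ← sq_eq_sq₀ (norm_nonneg _) (norm_nonneg _), h3, hz]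
  ring

theorem spectrum_cesaro : spectrum ℂ cesaro = Metric.sphere (1 : ℂ) 1 := by
  ext l
  rw [mem_sphere_iff_norm]
  constructor
  · intro hl
    by_contra h
    rcases Ne.lt_or_gt h with h | h
    · exact hl (resolvent_cesaro_of_lt_one h).1
    · exact hl (resolvent_cesaro_of_one_lt h).1
  · intro hl
    by_cases h0 : l = 0
    -- The origin is not of the form `z⁻¹` with `Re z = 1/2`, but it is a limit of such points and
    -- the spectrum is closed.
    · rw [h0]
      have ht : Tendsto (fun n : ℕ => ((1 / 2 : ℂ) + n * Complex.I)⁻¹) atTop (𝓝 0) := by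
        refine tendsto_inv₀_cobounded.comp (tendsto_norm_atTop_iff_cobounded.1 ?_)
        refine tendsto_atTop_mono (fun n => ?_) tendsto_natCast_atTop_atTop
        have := Complex.abs_im_le_norm ((1 / 2 : ℂ) + n * Complex.I)
        simpa using this
      refine (spectrum.isClosed cesaro).mem_of_tendsto ht (Eventually.of_forall fun n => ?_)
      exact inv_mem_spectrum_cesaro (by simp)
    · have := inv_mem_spectrum_cesaro (inv_re_of_norm_sub_one_eq h0 hl)
      rwa [inv_inv] at this

/-! ### Cauchy's formula and contour integrals of power kernels -/

/-- Cauchy's integral formula for an annulus. -/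
theorem circleIntegral_sub_inv_mul_annulus {F : ℂ → ℂ} {N : Set ℂ} (hN : IsOpen N)
    (hF : DifferentiableOn ℂ F N) {c μ : ℂ} {r R : ℝ} (hr : 0 < r)
    (hμr : r < ‖μ - c‖) (hμR : ‖μ - c‖ < R) (hsub : {z | r ≤ ‖z - c‖ ∧ ‖z - c‖ ≤ R} ⊆ N) :
    (∮ z in C(c, R), (z - μ)⁻¹ * F z) - (∮ z in C(c, r), (z - μ)⁻¹ * F z) =
      2 * Real.pi * Complex.I * F μ := by
  have hR : 0 < R := hr.trans (hμr.trans hμR)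
  have hμN : N ∈ 𝓝 μ := hN.mem_nhds (hsub ⟨hμr.le, hμR.le⟩)
  -- The difference quotient at `μ` has a removable singularity, so its integrals over the two
  -- circles agree; only the winding terms `∮ (z - μ)⁻¹ F(μ)` remain.
  have hd : DifferentiableOn ℂ (dslope F μ) N := (Complex.differentiableOn_dslope hμN).2 hF
  have hA : Metric.closedBall c R \ Metric.ball c r ⊆ N := fun z hz => hsub (by
    simp only [Set.mem_sdiff, mem_closedBall_iff_norm, mem_ball_iff_norm, not_lt] at hz
    exact ⟨hz.2, hz.1⟩)
  have heq := Complex.circleIntegral_eq_of_differentiable_on_annulus_off_countable hr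
    (hμr.trans hμR).le countable_empty (hd.continuousOn.mono hA) (fun z hz =>
      hd.differentiableAt (hN.mem_nhds (hA ⟨Metric.ball_subset_closedBall hz.1.1,
        fun h => hz.1.2 (Metric.ball_subset_closedBall h)⟩)))
  have key : ∀ ρ : ℝ, 0 < ρ → ρ ≠ ‖μ - c‖ → r ≤ ρ → ρ ≤ R →
      (∮ z in C(c, ρ), dslope F μ z) =
        (∮ z in C(c, ρ), (z - μ)⁻¹ * F z) - (∮ z in C(c, ρ), (z - μ)⁻¹) * F μ := by
    intro ρ hρ hne h1 h2
    have hz : ∀ z ∈ Metric.sphere c ρ, z ≠ μ := by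
      rintro z hz rfl
      exact hne (mem_sphere_iff_norm.1 hz).symm
    have hinv : ContinuousOn (fun z : ℂ => (z - μ)⁻¹) (Metric.sphere c ρ) :=
      (continuousOn_id.sub continuousOn_const).inv₀ fun z h => sub_ne_zero.2 (hz z h)
    have hFc : ContinuousOn F (Metric.sphere c ρ) := hF.continuousOn.mono fun z h => hsub (by
      rw [mem_sphere_iff_norm] at h
      exact ⟨h1.trans h.ge, h.le.trans h2⟩)
    have e1 : (∮ z in C(c, ρ), (z - μ)⁻¹) * F μ = ∮ z in C(c, ρ), (z - μ)⁻¹ * F μ := by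
      simp_rw [mul_comm _ (F μ)]
      rw [circleIntegral.integral_const_mul]
    have i1 : CircleIntegrable (fun z => (z - μ)⁻¹ * F z) c ρ :=
      (hinv.mul hFc).circleIntegrable hρ.le
    have i2 : CircleIntegrable (fun z => (z - μ)⁻¹ * F μ) c ρ :=
      (hinv.mul continuousOn_const).circleIntegrable hρ.le
    rw [e1, ← circleIntegral.integral_sub i1 i2]
    refine circleIntegral.integral_congr hρ.le fun z h => ?_
    rw [dslope_of_ne _ (hz z h), slope_def_field]
    ring
  rw [key R hR hμR.ne' (hμr.trans hμR).le le_rfl, key r hr hμr.ne le_rfl (hμr.trans hμR).le,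
    circleIntegral.integral_sub_inv_of_mem_ball (mem_ball_iff_norm.2 hμR)] at heq
  have h0 : (∮ z in C(c, r), (z - μ)⁻¹) = 0 := by
    have hz : ∀ z ∈ Metric.closedBall c r, z - μ ≠ 0 := by
      intro z hz h
      rw [sub_eq_zero.1 h, mem_closedBall_iff_norm] at hz
      linarith
    refine Complex.circleIntegral_eq_zero_of_differentiable_on_off_countable hr.le countable_empty
      ((continuousOn_id.sub continuousOn_const).inv₀ hz) fun z h => ?_
    exact (differentiableAt_id.sub_const μ).inv (hz z (Metric.ball_subset_closedBall h.1))
  rw [h0] at heq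
  linear_combination heq

/-- The power kernel `u^{-1/λ}` integrated over a circle of `λ`. -/
noncomputable def circlePowerIntegral (G : ℂ → ℂ) (ρ : ℝ) (u : ℝ) : ℂ :=
  ∮ l in C(1, ρ), G l * (u : ℂ) ^ (-l⁻¹)

section circlePower

variable {G : ℂ → ℂ} {ρ : ℝ}

theorem continuous_comp_circleMap (hρ : 0 ≤ ρ) (hG : ContinuousOn G (Metric.sphere 1 ρ)) :
    Continuous fun θ : ℝ => G (circleMap 1 ρ θ) :=
  hG.comp_continuous (continuous_circleMap 1 ρ) fun θ => circleMap_mem_sphere 1 hρ θ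

theorem measurable_circlePower_integrand (hρ : 0 ≤ ρ) (hG : ContinuousOn G (Metric.sphere 1 ρ)) :
    Measurable fun p : ℝ × ℝ => deriv (circleMap 1 ρ) p.1 *
      (G (circleMap 1 ρ p.1) * (p.2 : ℂ) ^ (-(circleMap 1 ρ p.1)⁻¹)) := by
  have h1 : Measurable fun p : ℝ × ℝ => G (circleMap 1 ρ p.1) :=
    (continuous_comp_circleMap hρ hG).measurable.comp measurable_fst
  have h2 : Measurable fun p : ℝ × ℝ => circleMap 1 ρ p.1 :=
    (continuous_circleMap 1 ρ).measurable.comp measurable_fst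
  have h3 : Measurable fun p : ℝ × ℝ => deriv (circleMap 1 ρ) p.1 := by
    simp only [deriv_circleMap]
    exact (((continuous_circleMap 0 ρ).measurable.comp measurable_fst).mul_const _)
  exact h3.mul (h1.mul ((Complex.measurable_ofReal.comp measurable_snd).pow h2.inv.neg))

theorem circlePowerIntegral_eq (G : ℂ → ℂ) (ρ u : ℝ) :
    circlePowerIntegral G ρ u = ∫ θ in Ioc 0 (2 * Real.pi), deriv (circleMap 1 ρ) θ *
      (G (circleMap 1 ρ θ) * (u : ℂ) ^ (-(circleMap 1 ρ θ)⁻¹)) := by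
  rw [circlePowerIntegral, circleIntegral, intervalIntegral.integral_of_le Real.two_pi_pos.le]
  simp only [smul_eq_mul]

theorem measurable_circlePowerIntegral (hρ : 0 ≤ ρ) (hG : ContinuousOn G (Metric.sphere 1 ρ)) :
    Measurable (circlePowerIntegral G ρ) := by
  have := (measurable_circlePower_integrand hρ hG).stronglyMeasurable.integral_prod_left'
    (μ := volume.restrict (Ioc 0 (2 * Real.pi)))
  rw [funext (circlePowerIntegral_eq G ρ)]
  exact this.measurable

theorem exists_norm_le_of_continuousOn_sphere (hG : ContinuousOn G (Metric.sphere 1 ρ)) :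
    ∃ M : ℝ, 0 ≤ M ∧ ∀ l ∈ Metric.sphere (1 : ℂ) ρ, ‖G l‖ ≤ M := by
  obtain ⟨M, hM⟩ := (isCompact_sphere (1 : ℂ) ρ).exists_bound_of_continuousOn hG
  exact ⟨max M 0, le_max_right _ _, fun l hl => (hM l hl).trans (le_max_left _ _)⟩

variable {S : Set ℝ} {q : ℝ}

/-- The exponent `q` is the worst one on the contour, so one power dominates all the integrands on
`S`. -/
theorem exists_norm_circlePowerIntegral_le (hρ : 0 ≤ ρ) (hG : ContinuousOn G (Metric.sphere 1 ρ))
    (hS0 : S ⊆ Ioi 0)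
    (hq : ∀ l ∈ Metric.sphere (1 : ℂ) ρ, ∀ u ∈ S, u ^ (-l⁻¹.re) ≤ u ^ q) :
    ∃ C : ℝ, ∀ u ∈ S, ‖circlePowerIntegral G ρ u‖ ≤ C * u ^ q := by
  obtain ⟨M, hM0, hM⟩ := exists_norm_le_of_continuousOn_sphere hG
  refine ⟨2 * Real.pi * ρ * M, fun u hu => ?_⟩
  have h0 : 0 < u := hS0 hu
  rw [mul_assoc]
  refine circleIntegral.norm_integral_le_of_norm_le_const hρ fun l hl => ?_
  rw [norm_mul, norm_ofReal_cpow_neg h0]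
  exact mul_le_mul (hM l hl) (hq l hl u hu) (by positivity) hM0

theorem isHausdorffKernel_circlePowerIntegral (hρ : 0 ≤ ρ)
    (hG : ContinuousOn G (Metric.sphere 1 ρ)) (hS : MeasurableSet S) (hS0 : S ⊆ Ioi 0)
    (hq : ∀ l ∈ Metric.sphere (1 : ℂ) ρ, ∀ u ∈ S, u ^ (-l⁻¹.re) ≤ u ^ q)
    (hint : IntegrableOn (fun u : ℝ => u ^ (q - 1 / 2)) S) :
    IsHausdorffKernel (S.indicator (circlePowerIntegral G ρ)) := by
  obtain ⟨C, hC⟩ := exists_norm_circlePowerIntegral_le hρ hG hS0 hq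
  exact isHausdorffKernel_indicator hS hS0 (measurable_circlePowerIntegral hρ hG) hC hint

/-- Fubini's theorem for a contour integral of power kernels. -/
theorem integral_circlePowerIntegral_mul (hρ : 0 ≤ ρ)
    (hG : ContinuousOn G (Metric.sphere 1 ρ)) (hS : MeasurableSet S) (hS0 : S ⊆ Ioi 0)
    (hq : ∀ l ∈ Metric.sphere (1 : ℂ) ρ, ∀ u ∈ S, u ^ (-l⁻¹.re) ≤ u ^ q)
    (hint : IntegrableOn (fun u : ℝ => u ^ (q - 1 / 2)) S) {φ : ℝ → ℂ} (hφ : Measurable φ) {C : ℝ}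
    (hC : ∀ u : ℝ, 0 < u → ‖φ u‖ ≤ C * u ^ (-(1 / 2) : ℝ)) :
    ∫ u in S, circlePowerIntegral G ρ u * φ u =
      ∮ l in C(1, ρ), G l * ∫ u in S, (u : ℂ) ^ (-l⁻¹) * φ u := by
  obtain ⟨M, hM0, hM⟩ := exists_norm_le_of_continuousOn_sphere hG
  set Ψ : ℝ × ℝ → ℂ := fun p => deriv (circleMap 1 ρ) p.1 *
      (G (circleMap 1 ρ p.1) * (p.2 : ℂ) ^ (-(circleMap 1 ρ p.1)⁻¹)) with hΨ
  have hΨm : Measurable Ψ := measurable_circlePower_integrand hρ hG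
  have hΦ : Integrable (fun p : ℝ × ℝ => Ψ p * φ p.2)
      ((volume.restrict (Ioc 0 (2 * Real.pi))).prod (volume.restrict S)) := by
    have hb : Integrable (fun p : ℝ × ℝ => (1 : ℝ) * (ρ * M * C * p.2 ^ (q - 1 / 2)))
        ((volume.restrict (Ioc 0 (2 * Real.pi))).prod (volume.restrict S)) :=
      (integrable_const (1 : ℝ)).mul_prod (hint.const_mul (ρ * M * C))
    refine hb.mono' (hΨm.mul (hφ.comp measurable_snd)).aestronglyMeasurable ?_
    rw [Measure.prod_restrict]
    filter_upwards [ae_restrict_mem (measurableSet_Ioc.prod hS)] with p hp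
    have hu : p.2 ∈ S := hp.2
    have h0 : 0 < p.2 := hS0 hu
    have hl : circleMap 1 ρ p.1 ∈ Metric.sphere (1 : ℂ) ρ := circleMap_mem_sphere 1 hρ _
    rw [one_mul, norm_mul, hΨ, norm_mul, norm_mul, norm_ofReal_cpow_neg h0, deriv_circleMap,
      norm_mul, Complex.norm_I, norm_circleMap_zero, mul_one, abs_of_nonneg hρ, sub_eq_add_neg,
      Real.rpow_add h0]
    calc ρ * (‖G (circleMap 1 ρ p.1)‖ * p.2 ^ (-(circleMap 1 ρ p.1)⁻¹.re)) * ‖φ p.2‖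
        ≤ ρ * (M * p.2 ^ q) * (C * p.2 ^ (-(1 / 2) : ℝ)) := by
          refine mul_le_mul (mul_le_mul_of_nonneg_left ?_ hρ) (hC _ h0) (norm_nonneg _)
            (by positivity)
          exact mul_le_mul (hM _ hl) (hq _ hl _ hu) (by positivity) hM0
      _ = _ := by ring
  calc ∫ u in S, circlePowerIntegral G ρ u * φ u
      = ∫ u in S, ∫ θ in Ioc 0 (2 * Real.pi), Ψ (θ, u) * φ u := by
        simp_rw [circlePowerIntegral_eq, integral_mul_const]
        rfl
    _ = ∫ θ in Ioc 0 (2 * Real.pi), ∫ u in S, Ψ (θ, u) * φ u := (integral_integral_swap hΦ).symm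
    _ = _ := by
        rw [circleIntegral, intervalIntegral.integral_of_le Real.two_pi_pos.le]
        refine integral_congr_ae (Eventually.of_forall fun θ => ?_)
        simp only [hΨ, smul_eq_mul]
        rw [← integral_const_mul, ← integral_const_mul]
        refine integral_congr_ae (Eventually.of_forall fun u => ?_)
        simp only
        ring

end circlePower

/-! ### The kernel of `F(𝒞) - F(0)` and its Mellin transform -/

theorem IsHausdorffKernel.add {K L : ℝ → ℂ} (hK : IsHausdorffKernel K) (hL : IsHausdorffKernel L) :
    IsHausdorffKernel fun u => K u + L u where
  measurable := hK.measurable.add hL.measurable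
  zero_of_nonpos u hu := by rw [hK.zero_of_nonpos u hu, hL.zero_of_nonpos u hu, add_zero]
  integrableOn := by
    simp only [add_mul]
    exact hK.integrableOn.add hL.integrableOn

theorem IsHausdorffKernel.const_mul {K : ℝ → ℂ} (hK : IsHausdorffKernel K) (c : ℂ) :
    IsHausdorffKernel fun u => c * K u where
  measurable := hK.measurable.const_mul c
  zero_of_nonpos u hu := by rw [hK.zero_of_nonpos u hu, mul_zero]
  integrableOn := by
    simp only [mul_assoc]
    exact hK.integrableOn.const_mul c

theorem integral_indicator_mul {S : Set ℝ} (hS : MeasurableSet S) (k φ : ℝ → ℂ) :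
    ∫ u, S.indicator k u * φ u = ∫ u in S, k u * φ u := by
  rw [← integral_indicator hS]
  refine integral_congr_ae (Eventually.of_forall fun u => ?_)
  by_cases hu : u ∈ S <;> simp [hu]

theorem rpow_neg_inv_re_le_inner {ρ : ℝ} (hρ : 1 < ρ) :
    ∀ l ∈ Metric.sphere (1 : ℂ) ρ, ∀ u ∈ Ioc (0 : ℝ) 1, u ^ (-l⁻¹.re) ≤ u ^ (-(1 / (1 + ρ))) := by
  intro l hl u hu
  rw [mem_sphere_iff_norm] at hl
  have := inv_re_le_of_norm_sub_one (hρ.trans_eq hl.symm)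
  rw [hl] at this
  exact Real.rpow_le_rpow_of_exponent_ge hu.1 hu.2 (by linarith)

theorem rpow_neg_inv_re_le_outer {ρ : ℝ} (hρ : ρ < 1) :
    ∀ l ∈ Metric.sphere (1 : ℂ) ρ, ∀ u ∈ Ioi (1 : ℝ), u ^ (-l⁻¹.re) ≤ u ^ (-(1 / (1 + ρ))) := by
  intro l hl u hu
  rw [mem_sphere_iff_norm] at hl
  have := le_inv_re_of_norm_sub_one (hl.trans_lt hρ)
  rw [hl] at this
  exact Real.rpow_le_rpow_of_exponent_le (le_of_lt hu) (by linarith)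

theorem integrableOn_inner_rpow {ρ : ℝ} (hρ : 1 < ρ) :
    IntegrableOn (fun u : ℝ => u ^ (-(1 / (1 + ρ)) - 1 / 2)) (Ioc 0 1) := by
  have : 1 / (1 + ρ) < 1 / 2 := one_div_lt_one_div_of_lt two_pos (by linarith)
  exact integrableOn_Ioc_rpow (by linarith) 1 zero_le_one

theorem integrableOn_outer_rpow {ρ : ℝ} (h0 : 0 < ρ) (hρ : ρ < 1) :
    IntegrableOn (fun u : ℝ => u ^ (-(1 / (1 + ρ)) - 1 / 2)) (Ioi 1) := by
  have : 1 / 2 < 1 / (1 + ρ) := one_div_lt_one_div_of_lt (by linarith) (by linarith)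
  exact integrableOn_Ioi_one_rpow (by linarith)

theorem ne_zero_of_mem_sphere_one {ρ : ℝ} (hρ : ρ ≠ 1) {l : ℂ} (hl : l ∈ Metric.sphere (1 : ℂ) ρ) :
    l ≠ 0 :=
  ne_zero_of_norm_sub_one_ne (by rwa [mem_sphere_iff_norm.1 hl])

theorem continuousOn_mul_inv_sq {F : ℂ → ℂ} {ρ : ℝ} (hρ : ρ ≠ 1)
    (hF : ContinuousOn F (Metric.sphere 1 ρ)) :
    ContinuousOn (fun l => F l * l⁻¹ ^ 2) (Metric.sphere 1 ρ) :=
  hF.mul ((continuousOn_id.inv₀ fun _ h => ne_zero_of_mem_sphere_one hρ h).pow 2)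

/-- The kernel of the Hausdorff operator `F(𝒞) - F(0)`. -/
noncomputable def holomorphicKernel (F : ℂ → ℂ) (r R : ℝ) (u : ℝ) : ℂ :=
  (2 * Real.pi * Complex.I : ℂ)⁻¹ *
    -- Both terms have a plus sign: the negative orientation of the inner circle cancels the sign of
    -- `outerPowerKernel`.
    ((Ioc (0 : ℝ) 1).indicator (circlePowerIntegral (fun l => F l * l⁻¹ ^ 2) R) u +
      (Ioi (1 : ℝ)).indicator (circlePowerIntegral (fun l => F l * l⁻¹ ^ 2) r) u)

section holomorphicKernel

variable {F : ℂ → ℂ} {r R : ℝ}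

theorem isHausdorffKernel_holomorphicKernel (hr0 : 0 < r) (hr : r < 1) (hR : 1 < R)
    (hFr : ContinuousOn F (Metric.sphere 1 r)) (hFR : ContinuousOn F (Metric.sphere 1 R)) :
    IsHausdorffKernel (holomorphicKernel F r R) :=
  ((isHausdorffKernel_circlePowerIntegral (by linarith) (continuousOn_mul_inv_sq hR.ne' hFR)
    measurableSet_Ioc Ioc_subset_Ioi_self (rpow_neg_inv_re_le_inner hR)
    (integrableOn_inner_rpow hR)).add
  (isHausdorffKernel_circlePowerIntegral hr0.le (continuousOn_mul_inv_sq hr.ne hFr)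
    measurableSet_Ioi (Ioi_subset_Ioi zero_le_one) (rpow_neg_inv_re_le_outer hr)
    (integrableOn_outer_rpow hr0 hr))).const_mul _

theorem integral_holomorphicKernel_mul (hr0 : 0 < r) (hr : r < 1) (hR : 1 < R)
    (hFr : ContinuousOn F (Metric.sphere 1 r)) (hFR : ContinuousOn F (Metric.sphere 1 R))
    {φ : ℝ → ℂ} (hφ : Measurable φ) {C : ℝ}
    (hC : ∀ u : ℝ, 0 < u → ‖φ u‖ ≤ C * u ^ (-(1 / 2) : ℝ)) :
    ∫ u, holomorphicKernel F r R u * φ u = (2 * Real.pi * Complex.I : ℂ)⁻¹ *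
      ((∮ l in C(1, R), F l * l⁻¹ ^ 2 * ∫ u in Ioc (0 : ℝ) 1, (u : ℂ) ^ (-l⁻¹) * φ u) +
        ∮ l in C(1, r), F l * l⁻¹ ^ 2 * ∫ u in Ioi (1 : ℝ), (u : ℂ) ^ (-l⁻¹) * φ u) := by
  have hR0 : 0 ≤ R := by linarith
  have hGR := continuousOn_mul_inv_sq hR.ne' hFR
  have hGr := continuousOn_mul_inv_sq hr.ne hFr
  have k1 := isHausdorffKernel_circlePowerIntegral hR0 hGR
    measurableSet_Ioc Ioc_subset_Ioi_self (rpow_neg_inv_re_le_inner hR)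
    (integrableOn_inner_rpow hR)
  have k2 := isHausdorffKernel_circlePowerIntegral hr0.le hGr
    measurableSet_Ioi (Ioi_subset_Ioi zero_le_one) (rpow_neg_inv_re_le_outer hr)
    (integrableOn_outer_rpow hr0 hr)
  simp only [holomorphicKernel, mul_assoc, add_mul]
  simp only [← mul_assoc (F _)]
  rw [integral_const_mul, integral_add (k1.integrable_mul hφ.aestronglyMeasurable hC)
      (k2.integrable_mul hφ.aestronglyMeasurable hC), integral_indicator_mul measurableSet_Ioc,
    integral_indicator_mul measurableSet_Ioi,
    integral_circlePowerIntegral_mul hR0 hGR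
    measurableSet_Ioc Ioc_subset_Ioi_self (rpow_neg_inv_re_le_inner hR)
    (integrableOn_inner_rpow hR) hφ hC,
    integral_circlePowerIntegral_mul hr0.le hGr
    measurableSet_Ioi (Ioi_subset_Ioi zero_le_one) (rpow_neg_inv_re_le_outer hr)
    (integrableOn_outer_rpow hr0 hr) hφ hC]

theorem integral_Ioc_cpow_mul_cpow {w z : ℂ} (h : w.re < z.re) :
    ∫ u in Ioc (0 : ℝ) 1, (u : ℂ) ^ (-w) * (u : ℂ) ^ (z - 1) = (z - w)⁻¹ := by
  have hne : z - 1 - w + 1 ≠ 0 := by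
    intro h0
    have := congrArg Complex.re h0
    simp at this
    linarith
  calc ∫ u in Ioc (0 : ℝ) 1, (u : ℂ) ^ (-w) * (u : ℂ) ^ (z - 1)
      = ∫ u in Ioc (0 : ℝ) 1, (u : ℂ) ^ (z - 1 - w) := by
        refine setIntegral_congr_fun measurableSet_Ioc fun u hu => ?_
        have h0 : (u : ℂ) ≠ 0 := by exact_mod_cast hu.1.ne'
        rw [← Complex.cpow_add _ _ h0]
        ring_nf
    _ = _ := by
        rw [← intervalIntegral.integral_of_le zero_le_one, integral_cpow (Or.inl (by
          rw [Complex.sub_re, Complex.sub_re, Complex.one_re]; linarith)), Complex.ofReal_one,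
          Complex.one_cpow, Complex.ofReal_zero, Complex.zero_cpow hne, sub_zero, one_div]
        ring_nf

theorem integral_Ioi_cpow_mul_cpow {w z : ℂ} (h : z.re < w.re) :
    ∫ u in Ioi (1 : ℝ), (u : ℂ) ^ (-w) * (u : ℂ) ^ (z - 1) = -(z - w)⁻¹ := by
  calc ∫ u in Ioi (1 : ℝ), (u : ℂ) ^ (-w) * (u : ℂ) ^ (z - 1)
      = ∫ u in Ioi (1 : ℝ), (u : ℂ) ^ (z - 1 - w) := by
        refine setIntegral_congr_fun measurableSet_Ioi fun u hu => ?_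
        have h0 : (u : ℂ) ≠ 0 := by exact_mod_cast (one_pos.trans hu).ne'
        rw [← Complex.cpow_add _ _ h0]
        ring_nf
    _ = _ := by
        rw [integral_Ioi_cpow_of_lt (by
          rw [Complex.sub_re, Complex.sub_re, Complex.one_re]; linarith) one_pos,
          Complex.ofReal_one, Complex.one_cpow, neg_div, one_div]
        ring_nf

theorem mellin_eq_integral_mul {K : ℝ → ℂ} (hK : ∀ u ≤ 0, K u = 0) (z : ℂ) :
    mellin K z = ∫ u : ℝ, K u * (u : ℂ) ^ (z - 1) := by
  rw [integral_eq_setIntegral_Ioi hK, mellin]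
  simp only [smul_eq_mul, mul_comm]

theorem mellin_holomorphicKernel {N : Set ℂ} (hN : IsOpen N) (hF : DifferentiableOn ℂ F N)
    (hr0 : 0 < r) (hr : r < 1) (hR : 1 < R) (hsub : {z | r ≤ ‖z - 1‖ ∧ ‖z - 1‖ ≤ R} ⊆ N)
    {z : ℂ} (hz : z.re = 1 / 2) : mellin (holomorphicKernel F r R) z = F z⁻¹ - F 0 := by
  have hz0 : z ≠ 0 := by
    rintro rfl
    norm_num at hz
  have hsph : ∀ ρ, r ≤ ρ → ρ ≤ R → Metric.sphere (1 : ℂ) ρ ⊆ N := fun ρ h1 h2 l hl => hsub (by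
    rw [mem_sphere_iff_norm] at hl
    exact ⟨h1.trans hl.ge, hl.le.trans h2⟩)
  have hFr : ContinuousOn F (Metric.sphere 1 r) := hF.continuousOn.mono (hsph r le_rfl (by linarith))
  have hFR : ContinuousOn F (Metric.sphere 1 R) := hF.continuousOn.mono (hsph R (by linarith) le_rfl)
  have hC : ∀ u : ℝ, 0 < u → ‖(u : ℂ) ^ (z - 1)‖ ≤ 1 * u ^ (-(1 / 2) : ℝ) := by
    intro u hu
    rw [Complex.norm_cpow_eq_rpow_re_of_pos hu, Complex.sub_re, hz, Complex.one_re]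
    norm_num
  rw [mellin_eq_integral_mul
      (isHausdorffKernel_holomorphicKernel hr0 hr hR hFr hFR).zero_of_nonpos,
    integral_holomorphicKernel_mul hr0 hr hR hFr hFR (by fun_prop) hC]
  have hlz : ∀ ρ, ρ ≠ 1 → ∀ l ∈ Metric.sphere (1 : ℂ) ρ, l - z⁻¹ ≠ 0 := by
    intro ρ hρ l hl h
    rw [mem_sphere_iff_norm, sub_eq_zero.1 h, norm_inv_sub_one hz] at hl
    exact hρ hl.symm
  -- The Mellin transforms of the power kernels produce `l⁻² (z - l⁻¹)⁻¹`, whose partial fractions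
  -- have poles at `z⁻¹` and `0`. Both lie on `|l - 1| = 1`, inside the annulus, so Cauchy's formula
  -- gives `F(z⁻¹) - F(0)`.
  have alg : ∀ l : ℂ, l ≠ 0 → l - z⁻¹ ≠ 0 →
      F l * l⁻¹ ^ 2 * (z - l⁻¹)⁻¹ = (l - z⁻¹)⁻¹ * F l - (l - 0)⁻¹ * F l := by
    intro l h0 h1
    have h2 : z * l - 1 ≠ 0 := by
      intro h
      apply h1
      field_simp
      linear_combination h
    have e1 : z - l⁻¹ = (z * l - 1) / l := by field_simp
    have e2 : l - z⁻¹ = (z * l - 1) / z := by field_simp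
    rw [e1, e2, sub_zero]
    generalize hd : z * l - 1 = d at h2
    field_simp
    linear_combination -F l * hd
  have key : ∀ ρ, 0 ≤ ρ → ρ ≠ 1 → ContinuousOn F (Metric.sphere 1 ρ) →
      (∮ l in C(1, ρ), F l * l⁻¹ ^ 2 * (z - l⁻¹)⁻¹) =
        (∮ l in C(1, ρ), (l - z⁻¹)⁻¹ * F l) - ∮ l in C(1, ρ), (l - 0)⁻¹ * F l := by
    intro ρ hρ0 hρ hFc
    have i1 : CircleIntegrable (fun l => (l - z⁻¹)⁻¹ * F l) 1 ρ :=
      (((continuousOn_id.sub continuousOn_const).inv₀ (hlz ρ hρ)).mul hFc).circleIntegrable hρ0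
    have i2 : CircleIntegrable (fun l => (l - 0)⁻¹ * F l) 1 ρ :=
      (((continuousOn_id.sub continuousOn_const).inv₀ fun l hl => by
        simpa using ne_zero_of_mem_sphere_one hρ hl).mul hFc).circleIntegrable hρ0
    rw [← circleIntegral.integral_sub i1 i2]
    exact circleIntegral.integral_congr hρ0 fun l hl =>
      alg l (ne_zero_of_mem_sphere_one hρ hl) (hlz ρ hρ l hl)
  have c1 : (∮ l in C(1, R), F l * l⁻¹ ^ 2 *
      ∫ u in Ioc (0 : ℝ) 1, (u : ℂ) ^ (-l⁻¹) * (u : ℂ) ^ (z - 1)) =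
      ∮ l in C(1, R), F l * l⁻¹ ^ 2 * (z - l⁻¹)⁻¹ := by
    refine circleIntegral.integral_congr (by linarith) fun l hl => ?_
    rw [integral_Ioc_cpow_mul_cpow]
    rw [hz]
    exact inv_re_lt_half (by rwa [mem_sphere_iff_norm.1 hl])
  have c2 : (∮ l in C(1, r), F l * l⁻¹ ^ 2 *
      ∫ u in Ioi (1 : ℝ), (u : ℂ) ^ (-l⁻¹) * (u : ℂ) ^ (z - 1)) =
      -∮ l in C(1, r), F l * l⁻¹ ^ 2 * (z - l⁻¹)⁻¹ := by
    rw [← neg_one_mul, ← circleIntegral.integral_const_mul]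
    refine circleIntegral.integral_congr hr0.le fun l hl => ?_
    rw [integral_Ioi_cpow_mul_cpow]
    · ring
    rw [hz]
    exact half_lt_inv_re (by rwa [mem_sphere_iff_norm.1 hl])
  have hμ := norm_inv_sub_one hz
  have h1 := circleIntegral_sub_inv_mul_annulus hN hF (c := 1) (μ := z⁻¹) hr0 (by rwa [hμ])
    (by rwa [hμ]) hsub
  have h2 := circleIntegral_sub_inv_mul_annulus hN hF (c := 1) (μ := 0) hr0 (by simpa using hr)
    (by simpa using hR) hsub
  rw [c1, c2, key R (by linarith) hR.ne' hFR, key r hr0.le hr.ne hFr]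
  have hpi : (2 * Real.pi * Complex.I : ℂ) ≠ 0 := Complex.two_pi_I_ne_zero
  rw [inv_mul_eq_iff_eq_mul₀ hpi]
  linear_combination h1 - h2

/-! ### The Riesz–Dunford integral of the Cesàro operator -/

theorem continuousOn_resolvent_cesaro {ρ : ℝ} (hρ : ρ ≠ 1) :
    ContinuousOn (resolvent cesaro) (Metric.sphere (1 : ℂ) ρ) := by
  intro l hl
  have : l ∈ resolventSet ℂ cesaro := by
    by_contra h
    have h' : l ∈ spectrum ℂ cesaro := h
    rw [spectrum_cesaro, mem_sphere_iff_norm] at h'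
    exact hρ ((mem_sphere_iff_norm.1 hl).symm.trans h')
  exact (spectrum.hasDerivAt_resolvent_const_left this).continuousAt.continuousWithinAt

/-- The functional `B ↦ ⟨g, B f⟩`. -/
noncomputable def weakFunctional (g f : L2R) : (L2R →L[ℂ] L2R) →L[ℂ] ℂ :=
  (innerSL ℂ g).comp (ContinuousLinearMap.apply ℂ L2R f)

theorem weakFunctional_apply (g f : L2R) (B : L2R →L[ℂ] L2R) :
    weakFunctional g f B = inner ℂ g (B f) := rfl

/-- This splits off the scalar part `l⁻¹` of the resolvent, which is common to both circles; what
remains is the Hausdorff part. -/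
theorem weakFunctional_circleIntegral {ρ : ℝ} (hρ0 : 0 ≤ ρ) (hρ : ρ ≠ 1)
    (hF : ContinuousOn F (Metric.sphere 1 ρ)) (g f : L2R) :
    weakFunctional g f (∮ l in C(1, ρ), F l • resolvent cesaro l) =
      (∮ l in C(1, ρ), (l - 0)⁻¹ * F l) * inner ℂ g f + ∮ l in C(1, ρ), F l *
        (weakFunctional g f (resolvent cesaro l) - l⁻¹ * inner ℂ g f) := by
  have hR := continuousOn_resolvent_cesaro hρ
  have hc : CircleIntegrable (fun l => F l • resolvent cesaro l) 1 ρ :=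
    (hF.smul hR).circleIntegrable hρ0
  have h1 : weakFunctional g f (∮ l in C(1, ρ), F l • resolvent cesaro l) =
      ∮ l in C(1, ρ), F l * weakFunctional g f (resolvent cesaro l) := by
    refine (ContinuousLinearMap.intervalIntegral_comp_comm (weakFunctional g f) hc.out).symm.trans ?_
    rw [circleIntegral]
    simp only [map_smul, smul_eq_mul]
  have hinv : ContinuousOn (fun l : ℂ => (l - 0)⁻¹ * F l) (Metric.sphere 1 ρ) :=
    ((continuousOn_id.sub continuousOn_const).inv₀ fun l hl => by
        simpa using ne_zero_of_mem_sphere_one hρ hl).mul hF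
  have i1 : CircleIntegrable (fun l => F l * weakFunctional g f (resolvent cesaro l)) 1 ρ :=
    (hF.mul ((weakFunctional g f).continuous.comp_continuousOn hR)).circleIntegrable hρ0
  have i2 : CircleIntegrable (fun l => inner ℂ g f * ((l - 0)⁻¹ * F l)) 1 ρ :=
    (continuousOn_const.mul hinv).circleIntegrable hρ0
  rw [h1, mul_comm (∮ l in C(1, ρ), (l - 0)⁻¹ * F l), ← circleIntegral.integral_const_mul,
    ← sub_eq_iff_eq_add', ← circleIntegral.integral_sub i1 i2]
  refine circleIntegral.integral_congr hρ0 fun l _ => ?_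
  simp only [sub_zero]
  ring

/-- Compared on matrix coefficients: the scalar parts combine to `F(0)` by Cauchy's formula at `0`,
and the Hausdorff parts match `integral_holomorphicKernel_mul` with `φ` the dilation pairing. -/
theorem rieszDunford_cesaro {N : Set ℂ} (hN : IsOpen N) (hF : DifferentiableOn ℂ F N)
    (hr0 : 0 < r) (hr : r < 1) (hR : 1 < R) (hsub : {z | r ≤ ‖z - 1‖ ∧ ‖z - 1‖ ≤ R} ⊆ N)
    (hK : IsHausdorffKernel (holomorphicKernel F r R)) :
    rieszDunford F cesaro 1 r R = F 0 • 1 + hK.operator := by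
  have hsph : ∀ ρ, r ≤ ρ → ρ ≤ R → Metric.sphere (1 : ℂ) ρ ⊆ N := fun ρ h1 h2 l hl => hsub (by
    rw [mem_sphere_iff_norm] at hl
    exact ⟨h1.trans hl.ge, hl.le.trans h2⟩)
  have hFr : ContinuousOn F (Metric.sphere 1 r) := hF.continuousOn.mono (hsph r le_rfl (by linarith))
  have hFR : ContinuousOn F (Metric.sphere 1 R) := hF.continuousOn.mono (hsph R (by linarith) le_rfl)
  refine L2R.operator_ext fun f g => ?_
  have hg := g.measurable_conj
  have hg2 := g.memLp_conj
  set P := dilationPairing (fun x => (starRingEnd ℂ) (g x)) f with hP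
  have hPm : Measurable P := measurable_dilationPairing hg f.measurable
  obtain ⟨C, hC⟩ := exists_norm_dilationPairing_le hg f.measurable hg2 (Lp.memLp f)
  have c1 : (∮ l in C(1, R), F l *
        (weakFunctional g f (resolvent cesaro l) - l⁻¹ * inner ℂ g f)) =
      ∮ l in C(1, R), F l * l⁻¹ ^ 2 * ∫ u in Ioc (0 : ℝ) 1, (u : ℂ) ^ (-l⁻¹) * P u := by
    refine circleIntegral.integral_congr (by linarith) fun l hl => ?_
    have hl1 : 1 < ‖l - 1‖ := by rwa [mem_sphere_iff_norm.1 hl]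
    have hk := isHausdorffKernel_innerPowerKernel (inv_re_lt_half hl1)
    rw [weakFunctional_apply, (resolvent_cesaro_of_one_lt hl1).2, add_apply, smul_apply,
      smul_apply, inner_add_right, inner_smul_right, inner_smul_right, one_apply_eq_self,
      add_sub_cancel_left, L2R.inner_eq, hk.isHausdorffOperator.integral_mul hk f hg hg2,
      innerPowerKernel, integral_indicator_mul measurableSet_Ioc, mul_assoc]
  have c2 : (∮ l in C(1, r), F l *
        (weakFunctional g f (resolvent cesaro l) - l⁻¹ * inner ℂ g f)) =
      -∮ l in C(1, r), F l * l⁻¹ ^ 2 * ∫ u in Ioi (1 : ℝ), (u : ℂ) ^ (-l⁻¹) * P u := by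
    rw [← neg_one_mul, ← circleIntegral.integral_const_mul]
    refine circleIntegral.integral_congr hr0.le fun l hl => ?_
    have hl1 : ‖l - 1‖ < 1 := by rwa [mem_sphere_iff_norm.1 hl]
    have hk := isHausdorffKernel_outerPowerKernel (half_lt_inv_re hl1)
    rw [weakFunctional_apply, (resolvent_cesaro_of_lt_one hl1).2, add_apply, smul_apply,
      smul_apply, inner_add_right, inner_smul_right, inner_smul_right, one_apply_eq_self,
      add_sub_cancel_left, L2R.inner_eq, hk.isHausdorffOperator.integral_mul hk f hg hg2,
      outerPowerKernel, integral_indicator_mul measurableSet_Ioi]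
    simp only [neg_mul, integral_neg]
    ring
  have h2 := circleIntegral_sub_inv_mul_annulus hN hF (c := 1) (μ := 0) hr0 (by simpa using hr)
    (by simpa using hR) hsub
  have hpi : (2 * Real.pi * Complex.I : ℂ) ≠ 0 := Complex.two_pi_I_ne_zero
  rw [← weakFunctional_apply, rieszDunford, map_smul, map_sub,
    weakFunctional_circleIntegral (by linarith) hR.ne' hFR,
    weakFunctional_circleIntegral hr0.le hr.ne hFr, c1, c2, add_apply, smul_apply,
    inner_add_right, inner_smul_right, one_apply_eq_self, L2R.inner_eq g (hK.operator f),
    hK.isHausdorffOperator.integral_mul hK f hg hg2,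
    integral_holomorphicKernel_mul hr0 hr hR hFr hFR hPm hC, smul_eq_mul,
    inv_mul_eq_iff_eq_mul₀ hpi, mul_add, mul_inv_cancel_left₀ hpi]
  linear_combination h2 * inner ℂ g f

end holomorphicKernel

/-! ### Injectivity of the Mellin transform on `Re z = 1/2` -/

open FourierTransform in
/-- The Fourier transform is injective on integrable functions. -/
theorem ae_eq_zero_of_fourier_eq_zero {h : ℝ → ℂ} (hh : Integrable h) (h0 : ∀ ξ, 𝓕 h ξ = 0) :
    ∀ᵐ x, h x = 0 := by
  refine ae_eq_zero_of_integral_contDiff_smul_eq_zero hh.locallyIntegrable fun g g_smooth g_cpt => ?_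
  have hg1 : HasCompactSupport (Complex.ofRealCLM ∘ g) := g_cpt.comp_left rfl
  have hg2 := Complex.ofRealCLM.contDiff.comp g_smooth
  set φ : SchwartzMap ℝ ℂ := hg1.toSchwartzMap hg2 with hφ
  -- A test function is the Fourier transform of a Schwartz function, so the multiplication formula
  -- shows that `h` annihilates it.
  set ψ : SchwartzMap ℝ ℂ := 𝓕⁻ φ with hψ
  have h1 : 𝓕 ψ = φ := FourierTransform.fourier_fourierInv_eq φ
  have h2 : ∫ ξ, 𝓕 h ξ • ψ ξ = ∫ x, h x • 𝓕 (ψ : ℝ → ℂ) x := by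
    simpa using! VectorFourier.integral_fourierIntegral_smul_eq_flip (L := innerₗ ℝ)
      Real.continuous_fourierChar continuous_inner hh ψ.integrable
  have h3 : ∀ x, 𝓕 (ψ : ℝ → ℂ) x = g x := fun x => by
    rw [← SchwartzMap.fourier_coe, h1]
    rfl
  simp only [h0, zero_smul, integral_zero, h3] at h2
  rw [h2]
  refine integral_congr_ae (Eventually.of_forall fun x => ?_)
  simp only [Complex.real_smul, smul_eq_mul, mul_comm]

theorem hasDerivWithinAt_exp_neg (x : ℝ) (s : Set ℝ) :
    HasDerivWithinAt (fun x : ℝ => Real.exp (-x)) (-Real.exp (-x)) s x := by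
  simpa using ((hasDerivAt_neg x).exp).hasDerivWithinAt

theorem image_exp_neg_univ : (fun x : ℝ => Real.exp (-x)) '' univ = Ioi 0 := by
  ext u
  simp only [mem_image, mem_univ, true_and, mem_Ioi]
  refine ⟨fun ⟨x, hx⟩ => hx ▸ Real.exp_pos _, fun hu => ⟨-Real.log u, ?_⟩⟩
  rw [neg_neg, Real.exp_log hu]

/-- The substitution `u = e^{-x}` with Jacobian `e^{-x}`: condition (b) becomes integrability of the
function whose Fourier transform is the Mellin transform on the line. -/
theorem integrable_exp_smul_comp_exp_neg {D : ℝ → ℂ}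
    (hD : IntegrableOn (fun u : ℝ => D u * ((u ^ (-(1 / 2) : ℝ) : ℝ) : ℂ)) (Ioi 0)) :
    Integrable fun x : ℝ => Real.exp (-(1 / 2) * x) • D (Real.exp (-x)) := by
  rw [← image_exp_neg_univ, integrableOn_image_iff_integrableOn_abs_deriv_smul MeasurableSet.univ
    (fun x _ => hasDerivWithinAt_exp_neg x univ)
    (Real.exp_injective.comp neg_injective).injOn, integrableOn_univ] at hD
  refine hD.congr (Eventually.of_forall fun x => ?_)
  have : Real.exp (-x) * Real.exp (-x) ^ (-(1 / 2) : ℝ) = Real.exp (-(1 / 2) * x) := by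
    rw [← Real.exp_mul, ← Real.exp_add]
    ring_nf
  simp only [abs_neg, abs_of_pos (Real.exp_pos _), Complex.real_smul]
  rw [← this, Complex.ofReal_mul]
  ring

/-- A function whose Mellin transform is constant on `Re z = 1/2` vanishes. -/
theorem eq_zero_of_mellin_const {D : ℝ → ℂ}
    (hD : IntegrableOn (fun u : ℝ => D u * ((u ^ (-(1 / 2) : ℝ) : ℝ) : ℂ)) (Ioi 0)) {c : ℂ}
    (hc : ∀ z : ℂ, z.re = 1 / 2 → mellin D z = c) :
    c = 0 ∧ ∀ᵐ u : ℝ, 0 < u → D u = 0 := by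
  set h : ℝ → ℂ := fun x : ℝ => Real.exp (-(1 / 2) * x) • D (Real.exp (-x)) with hh
  have hint : Integrable h := integrable_exp_smul_comp_exp_neg hD
  have hF : ∀ ξ : ℝ, FourierTransform.fourier h ξ = c := by
    intro ξ
    have := hc (1 / 2 + (2 * Real.pi * ξ : ℝ) * Complex.I) (by simp)
    rw [mellin_eq_fourier] at this
    rw [← this]
    have e1 : (1 / 2 + ((2 * Real.pi * ξ : ℝ) : ℂ) * Complex.I).re = 1 / 2 := by simp
    have e2 : (1 / 2 + ((2 * Real.pi * ξ : ℝ) : ℂ) * Complex.I).im = 2 * Real.pi * ξ := by simp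
    rw [e1, e2, mul_div_cancel_left₀ _ Real.two_pi_pos.ne']
  -- Riemann–Lebesgue: the constant is the limit at infinity of a Fourier transform.
  have hc0 : c = 0 := by
    have h1 := Real.zero_at_infty_fourier h
    have h2 : FourierTransform.fourier h = fun _ => c := funext hF
    rw [h2] at h1
    exact tendsto_nhds_unique tendsto_const_nhds h1
  refine ⟨hc0, ?_⟩
  have hae := ae_eq_zero_of_fourier_eq_zero hint fun ξ => (hF ξ).trans hc0
  -- The exceptional set on the half line is the image of a null set under the differentiable map `x
  -- ↦ e^{-x}`, hence null.
  have himg := addHaar_image_eq_zero_of_differentiableOn_of_addHaar_eq_zero volume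
    (f := fun x : ℝ => Real.exp (-x)) (s := {x | ¬ h x = 0})
    (fun x _ => (hasDerivWithinAt_exp_neg x _).differentiableWithinAt) (ae_iff.1 hae)
  refine ae_iff.2 (measure_mono_null (fun u hu => ?_) himg)
  simp only [Classical.not_imp, mem_ofPred_eq] at hu
  refine ⟨-Real.log u, ?_, by simp only [neg_neg, Real.exp_log hu.1]⟩
  simp only [mem_ofPred_eq, hh, neg_neg, Real.exp_log hu.1]
  exact smul_ne_zero (Real.exp_pos _).ne' hu.2

theorem integrableOn_cpow_smul {K : ℝ → ℂ}
    (hK : IntegrableOn (fun u : ℝ => K u * ((u ^ (-(1 / 2) : ℝ) : ℝ) : ℂ)) (Ioi 0)) {z : ℂ}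
    (hz : z.re = 1 / 2) : MellinConvergent K z := by
  have hm : Measurable fun u : ℝ => (u : ℂ) ^ (z - 1 / 2) := by fun_prop
  have h1 := hK.mul_bdd (g := fun u : ℝ => (u : ℂ) ^ (z - 1 / 2)) (c := 1) hm.aestronglyMeasurable
    (by
      filter_upwards [ae_restrict_mem measurableSet_Ioi] with u hu
      rw [Complex.norm_cpow_eq_rpow_re_of_pos hu]
      simp [hz])
  refine IntegrableOn.congr_fun h1 (fun u hu => ?_) measurableSet_Ioi
  have h0 : (u : ℂ) ≠ 0 := by exact_mod_cast (ne_of_gt hu)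
  simp only [smul_eq_mul]
  rw [Complex.ofReal_cpow (le_of_lt hu), mul_assoc, ← Complex.cpow_add _ _ h0, mul_comm]
  congr 2
  push_cast
  ring

/-- A kernel is determined by its Mellin transform on `Re z = 1/2`, even up to a constant. -/
theorem eq_of_mellin_sub_const {K L : ℝ → ℂ}
    (hK : IntegrableOn (fun u : ℝ => K u * ((u ^ (-(1 / 2) : ℝ) : ℝ) : ℂ)) (Ioi 0))
    (hL : IntegrableOn (fun u : ℝ => L u * ((u ^ (-(1 / 2) : ℝ) : ℝ) : ℂ)) (Ioi 0))
    (hK0 : ∀ᵐ u : ℝ, u < 0 → K u = 0) (hL0 : ∀ᵐ u : ℝ, u < 0 → L u = 0) {c : ℂ}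
    (hc : ∀ z : ℂ, z.re = 1 / 2 → mellin K z - mellin L z = c) : c = 0 ∧ K =ᵐ[volume] L := by
  have hD : IntegrableOn (fun u : ℝ => (K u - L u) * ((u ^ (-(1 / 2) : ℝ) : ℝ) : ℂ)) (Ioi 0) := by
    simp only [sub_mul]
    exact hK.sub hL
  obtain ⟨h0, h1⟩ := eq_zero_of_mellin_const hD (c := c) fun z hz => by
    rw [← hc z hz, mellin, mellin, mellin,
      ← integral_sub (integrableOn_cpow_smul hK hz) (integrableOn_cpow_smul hL hz)]
    simp only [smul_sub]
  refine ⟨h0, ?_⟩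
  filter_upwards [h1, hK0, hL0, ae_ne_zero] with u e1 e2 e3 e4
  rcases e4.lt_or_gt with hu | hu
  · rw [e2 hu, e3 hu]
  · exact sub_eq_zero.1 (e1 hu)

/-! ### Uniqueness of the kernel without growth assumptions -/

/-- Good points are dense, so there are good `x⁻¹` arbitrarily far out on both sides and `D` is
locally integrable. Its primitive is then continuous and vanishes on a dense set, hence everywhere,
and Lebesgue differentiation gives `D = 0`. -/
theorem ae_eq_zero_of_ae_intervalIntegral_inv {D : ℝ → ℂ}
    (h : ∀ᵐ x : ℝ, IntervalIntegrable D volume 0 x⁻¹ ∧ ∫ u in (0 : ℝ)..x⁻¹, D u = 0) :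
    D =ᵐ[volume] 0 := by
  have hd : Dense {x : ℝ | IntervalIntegrable D volume 0 x⁻¹ ∧ ∫ u in (0 : ℝ)..x⁻¹, D u = 0} :=
    Measure.dense_of_ae h
  have hpos : ∀ y : ℝ, 0 < y → IntervalIntegrable D volume 0 y := by
    intro y hy
    obtain ⟨x, hx, hx1, hx2⟩ := hd.exists_between (inv_pos.2 hy)
    have : y ≤ x⁻¹ := by
      rw [le_inv_comm₀ hy hx1]
      exact hx2.le
    refine hx.1.mono_set ?_
    rw [uIcc_of_le hy.le, uIcc_of_le (hy.le.trans this)]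
    exact Icc_subset_Icc_right this
  have hneg : ∀ y : ℝ, 0 < y → IntervalIntegrable D volume 0 (-y) := by
    intro y hy
    obtain ⟨x, hx, hx1, hx2⟩ := hd.exists_between (neg_lt_zero.2 (inv_pos.2 hy))
    have hx0 : 0 < -x := by linarith
    have : y ≤ -x⁻¹ := by
      rw [← inv_neg, le_inv_comm₀ hy hx0]
      linarith
    refine hx.1.mono_set ?_
    rw [uIcc_of_ge (by linarith), uIcc_of_ge (by linarith)]
    exact Icc_subset_Icc_left (by linarith)
  have hall : ∀ a b : ℝ, IntervalIntegrable D volume a b := by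
    have h0 : ∀ a : ℝ, IntervalIntegrable D volume 0 a := by
      intro a
      rcases lt_trichotomy a 0 with ha | ha | ha
      · simpa using hneg (-a) (by linarith)
      · rw [ha]
      · exact hpos a ha
    exact fun a b => (h0 a).symm.trans (h0 b)
  have hloc : LocallyIntegrable D volume := by
    intro x
    refine ⟨Ioc (x - 1) (x + 1), Ioc_mem_nhds (by linarith) (by linarith), ?_⟩
    exact (intervalIntegrable_iff_integrableOn_Ioc_of_le (by linarith)).1 (hall _ _)
  have hcont : Continuous fun y : ℝ => ∫ u in (0 : ℝ)..y, D u :=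
    intervalIntegral.continuous_primitive hall 0
  have hzero : ∀ y : ℝ, ∫ u in (0 : ℝ)..y, D u = 0 := by
    intro y
    by_cases hy : y = 0
    · rw [hy, intervalIntegral.integral_same]
    obtain ⟨x, hx, hlim⟩ := mem_closure_iff_seq_limit.1 (hd y⁻¹)
    have h1 := (hcont.tendsto y).comp ((inv_inv y) ▸ hlim.inv₀ (inv_ne_zero hy))
    refine tendsto_nhds_unique h1 ?_
    have h2 : ((fun y : ℝ => ∫ u in (0 : ℝ)..y, D u) ∘ fun n => (x n)⁻¹) = fun _ => 0 :=
      funext fun n => (hx n).2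
    rw [h2]
    exact tendsto_const_nhds
  filter_upwards [_root_.LocallyIntegrable.ae_hasDerivAt_integral hloc] with x hx
  have h1 := hx 0
  simp only [hzero] at h1
  exact h1.unique (hasDerivAt_const x 0)

theorem memLp_indicator_Ioc_one :
    MemLp ((Ioc (0 : ℝ) 1).indicator fun _ => (1 : ℂ)) 2 volume :=
  memLp_indicator_const 2 measurableSet_Ioc 1 (Or.inr (by simp))

/-- The kernel of a Hausdorff operator is unique. -/
theorem IsHausdorffOperator.kernel_unique {K K' : ℝ → ℂ} {T : L2R →L[ℂ] L2R}
    (h : IsHausdorffOperator K T) (h' : IsHausdorffOperator K' T) : K' =ᵐ[volume] K := by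
  have key : (fun u => K' u - K u) =ᵐ[volume] 0 := by
    refine ae_eq_zero_of_ae_intervalIntegral_inv ?_
    -- With `f = 1_{(0,1]}`, `u ↦ f(ux)` is the indicator of the interval between `0` and `x⁻¹`, so
    -- equality of the two operators at `f` says that the primitive of `K' - K` vanishes at almost
    -- every `x⁻¹`.
    set f : L2R := memLp_indicator_Ioc_one.toLp _
    filter_upwards [h f, h' f, ae_ne_zero] with x h1 h2 hx
    have hf := ae_eq_comp_mul (MemLp.coeFn_toLp memLp_indicator_Ioc_one) hx
    have hi := h2.1.sub h1.1
    have hz : ∫ u, (K' u * f (u * x) - K u * f (u * x)) = 0 := by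
      rw [integral_sub h2.1 h1.1, ← h1.2, ← h2.2, sub_self]
    rcases hx.lt_or_gt with hx | hx
    · have hx' : x⁻¹ ≤ 0 := (inv_lt_zero.2 hx).le
      have he : (fun u => K' u * f (u * x) - K u * f (u * x)) =ᵐ[volume]
          (Ico x⁻¹ 0).indicator fun u => K' u - K u := by
        filter_upwards [hf] with u hu
        rw [hu]
        have hiff : u * x ∈ Ioc (0 : ℝ) 1 ↔ u ∈ Ico x⁻¹ 0 := by
          rw [mem_Ioc, mem_Ico, ← div_le_iff_of_neg hx, one_div, and_comm]
          exact and_congr_right fun _ => ⟨fun h => by nlinarith, fun h => by nlinarith⟩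
        by_cases hm : u ∈ Ico x⁻¹ 0
        · rw [indicator_of_mem (hiff.2 hm), indicator_of_mem hm, mul_one, mul_one]
        · rw [indicator_of_notMem (fun h => hm (hiff.1 h)), indicator_of_notMem hm, mul_zero,
            mul_zero, sub_zero]
      rw [integral_congr_ae he, integral_indicator measurableSet_Ico,
        integral_Ico_eq_integral_Ioc] at hz
      have hi2 := (integrable_indicator_iff measurableSet_Ico).1 (hi.congr he)
      refine ⟨IntervalIntegrable.symm ?_, by
        rw [intervalIntegral.integral_of_ge hx', hz, neg_zero]⟩
      rw [intervalIntegrable_iff_integrableOn_Ioc_of_le hx']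
      exact hi2.congr_set_ae Ico_ae_eq_Ioc.symm
    · have hx' : 0 ≤ x⁻¹ := (inv_pos.2 hx).le
      have he : (fun u => K' u * f (u * x) - K u * f (u * x)) =ᵐ[volume]
          (Ioc 0 x⁻¹).indicator fun u => K' u - K u := by
        filter_upwards [hf] with u hu
        rw [hu]
        have hiff : u * x ∈ Ioc (0 : ℝ) 1 ↔ u ∈ Ioc 0 x⁻¹ := by
          rw [mem_Ioc, mem_Ioc, ← le_div_iff₀ hx, one_div, mul_pos_iff_of_pos_right hx]
        by_cases hm : u ∈ Ioc 0 x⁻¹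
        · rw [indicator_of_mem (hiff.2 hm), indicator_of_mem hm, mul_one, mul_one]
        · rw [indicator_of_notMem (fun h => hm (hiff.1 h)), indicator_of_notMem hm, mul_zero,
            mul_zero, sub_zero]
      rw [integral_congr_ae he, integral_indicator measurableSet_Ioc] at hz
      have hi2 := (integrable_indicator_iff measurableSet_Ioc).1 (hi.congr he)
      refine ⟨?_, by rw [intervalIntegral.integral_of_le hx', hz]⟩
      rwa [intervalIntegrable_iff_integrableOn_Ioc_of_le hx']
  filter_upwards [key] with u hu
  exact sub_eq_zero.1 hu

/-! ### Admissible annuli and the theorem -/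

theorem exists_annulus_subset {N : Set ℂ} (hN : IsOpen N) (hsub : Metric.sphere (1 : ℂ) 1 ⊆ N) :
    ∃ r R : ℝ, 0 < r ∧ r < 1 ∧ 1 < R ∧ {z : ℂ | r ≤ ‖z - 1‖ ∧ ‖z - 1‖ ≤ R} ⊆ N := by
  obtain ⟨δ, hδ, hδN⟩ := (isCompact_sphere (1 : ℂ) 1).exists_cthickening_subset_open hN hsub
  have hm : 0 < min δ (1 / 2) := lt_min hδ one_half_pos
  have hm1 : min δ (1 / 2) ≤ δ := min_le_left _ _
  have hm2 : min δ (1 / 2) ≤ 1 / 2 := min_le_right _ _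
  refine ⟨1 - min δ (1 / 2), 1 + min δ (1 / 2), by linarith, by linarith, by linarith,
    fun z hz => hδN ?_⟩
  have h0 : 0 < ‖z - 1‖ := by linarith [hz.1]
  have h0' : (‖z - 1‖ : ℂ) ≠ 0 := by exact_mod_cast h0.ne'
  -- The radial projection of `z` to the circle lies at distance `|‖z - 1‖ - 1|`. The cap `1/2` on
  -- the width keeps the inner radius positive, so the projection is defined.
  refine Metric.mem_cthickening_of_dist_le z (1 + (z - 1) / ‖z - 1‖) δ _ ?_ ?_
  · rw [mem_sphere_iff_norm, add_sub_cancel_left, norm_div, Complex.norm_real, norm_norm,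
      div_self h0.ne']
  · have e : z - (1 + (z - 1) / ‖z - 1‖) = (z - 1) * (((‖z - 1‖ - 1) / ‖z - 1‖ : ℝ) : ℂ) := by
      push_cast
      field_simp
      ring
    rw [dist_eq_norm, e, norm_mul, Complex.norm_real, Real.norm_eq_abs, abs_div, abs_norm,
      mul_div_cancel₀ _ h0.ne', abs_le]
    exact ⟨by linarith [hz.1], by linarith [hz.2]⟩

theorem IsAdmissibleAnnulus.cesaro_bounds {N : Set ℂ} {r R : ℝ}
    (h : IsAdmissibleAnnulus cesaro N 1 r R) : r < 1 ∧ 1 < R := by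
  -- Any single point of the spectrum gives both bounds, as all are at distance `1` from the centre.
  have h2 : (2 : ℂ) ∈ spectrum ℂ cesaro := by
    rw [spectrum_cesaro, mem_sphere_iff_norm]
    norm_num
  have := h.spectrum_subset h2
  norm_num at this
  exact this

theorem continuousOn_sphere_of_annulus_subset {F : ℂ → ℂ} {N : Set ℂ} (hF : ContinuousOn F N)
    {r R ρ : ℝ} (hsub : {z : ℂ | r ≤ ‖z - 1‖ ∧ ‖z - 1‖ ≤ R} ⊆ N) (h1 : r ≤ ρ) (h2 : ρ ≤ R) :
    ContinuousOn F (Metric.sphere 1 ρ) :=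
  hF.mono fun l hl => hsub (by
    rw [mem_sphere_iff_norm] at hl
    exact ⟨h1.trans hl.ge, hl.le.trans h2⟩)

theorem mainTheorem1 :
    spectrum ℂ cesaro = Metric.sphere (1 : ℂ) 1 ∧
    ∀ (N : Set ℂ) (F : ℂ → ℂ), IsOpen N → Metric.sphere (1 : ℂ) 1 ⊆ N → DifferentiableOn ℂ F N →
      ∃ T : L2R →L[ℂ] L2R, IsHolomorphicFunctionOf F N 1 cesaro T ∧
        (F 0 = 0 →
          ∃ K : ℝ → ℂ, IsHausdorffOperator K T ∧
            (∀ᵐ u : ℝ, u < 0 → K u = 0) ∧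
            IntegrableOn (fun u : ℝ => K u * ((u ^ (-(1 / 2) : ℝ) : ℝ) : ℂ)) (Set.Ioi 0) ∧
            (∀ z : ℂ, z.re = 1 / 2 → mellin K z = F z⁻¹) ∧
            ∀ K' : ℝ → ℂ, IsHausdorffOperator K' T → K' =ᵐ[volume] K) ∧
        (∀ K : ℝ → ℂ,
          (∀ᵐ u : ℝ, u < 0 → K u = 0) →
          IntegrableOn (fun u : ℝ => K u * ((u ^ (-(1 / 2) : ℝ) : ℝ) : ℂ)) (Set.Ioi 0) →
          (∀ z : ℂ, z.re = 1 / 2 → mellin K z = F z⁻¹) →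
          F 0 = 0 ∧ IsHausdorffOperator K T) := by
  refine ⟨spectrum_cesaro, fun N F hN hsub hF => ?_⟩
  obtain ⟨r, R, hr0, hr, hR, hA⟩ := exists_annulus_subset hN hsub
  have kernel : ∀ r R : ℝ, 0 < r → r < 1 → 1 < R → {z : ℂ | r ≤ ‖z - 1‖ ∧ ‖z - 1‖ ≤ R} ⊆ N →
      IsHausdorffKernel (holomorphicKernel F r R) := fun r R hr0 hr hR hA =>
    isHausdorffKernel_holomorphicKernel hr0 hr hR
      (continuousOn_sphere_of_annulus_subset hF.continuousOn hA le_rfl (by linarith))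
      (continuousOn_sphere_of_annulus_subset hF.continuousOn hA (by linarith) le_rfl)
  have hK := kernel r R hr0 hr hR hA
  have hneg : ∀ {K : ℝ → ℂ}, IsHausdorffKernel K → ∀ᵐ u : ℝ, u < 0 → K u = 0 := fun hK =>
    Eventually.of_forall fun u hu => hK.zero_of_nonpos u hu.le
  have hmel : ∀ z : ℂ, z.re = 1 / 2 → mellin (holomorphicKernel F r R) z = F z⁻¹ - F 0 :=
    fun z hz => mellin_holomorphicKernel hN hF hr0 hr hR hA hz
  refine ⟨F 0 • 1 + hK.operator, ⟨⟨r, R, ⟨hr0, by linarith, ?_, hA⟩⟩, ?_⟩, ?_, ?_⟩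
  · intro l hl
    rw [spectrum_cesaro, mem_sphere_iff_norm] at hl
    exact ⟨hr.trans_eq hl.symm, hl.trans_lt hR⟩
  · intro r' R' h
    obtain ⟨hr', hR'⟩ := h.cesaro_bounds
    have hK' := kernel r' R' h.inner_pos hr' hR' h.closed_subset
    rw [rieszDunford_cesaro hN hF h.inner_pos hr' hR' h.closed_subset hK']
    -- Independence of the annulus: both kernels have the Mellin transform `F(1/z) - F(0)` on the
    -- line, so they agree almost everywhere.
    have he := (eq_of_mellin_sub_const hK.integrableOn hK'.integrableOn (hneg hK) (hneg hK')
      (c := 0) fun z hz => by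
        rw [hmel z hz, mellin_holomorphicKernel hN hF h.inner_pos hr' hR' h.closed_subset hz,
          sub_self]).2
    rw [(hK.isHausdorffOperator.congr he).unique hK'.isHausdorffOperator]
  · intro h0
    have hT : IsHausdorffOperator (holomorphicKernel F r R) (F 0 • 1 + hK.operator) := by
      rw [h0, zero_smul, zero_add]
      exact hK.isHausdorffOperator
    exact ⟨_, hT, hneg hK, hK.integrableOn, fun z hz => by rw [hmel z hz, h0, sub_zero],
      fun K' hK' => hT.kernel_unique hK'⟩
  · intro K hK0 hKi hKm
    -- The Mellin transforms of `K` and of the constructed kernel differ by `F 0`; being constant on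
    -- the line, this difference must be zero.
    obtain ⟨h0, he⟩ := eq_of_mellin_sub_const hKi hK.integrableOn hK0 (hneg hK) (c := F 0)
      fun z hz => by rw [hKm z hz, hmel z hz, sub_sub_cancel]
    refine ⟨h0, ?_⟩
    rw [h0, zero_smul, zero_add]
    exact hK.isHausdorffOperator.congr he.symm
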